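/- Let $n\ge 0$, let $\langle x_1,\dots,x_n\mid R\rangle$ be a presentation (with an arbitrary set $R$ of relators) of a group $G$, and let $\mathcal G$ be its Cayley graph: the vertices are the elements of $G$, and for each $g\in G$ and each $j\in\{1,\dots,n\}$ there is one edge from $g$ to $gx_j$ (so loops and multiple edges may occur). For a finite nonempty subgraph $\mathcal G'$ of $\mathcal G$ let $\xi(\mathcal G')=\beta_2(\mathcal G')/\beta_0(\mathcal G')$, where $\beta_0(\mathcal G')$ is the number of vertices of $\mathcal G'$ and $\beta_2(\mathcal G')$ is its cyclomatic number, i.e. the sum of $\operatorname{rank}\pi_1(\mathcal H)$ over the connected components $\mathcal H$ of $\mathcal G'$. An exhausting chain is a sequence $\mathcal G_1\subseteq\mathcal G_2\subseteq\cdots$ of finite connected (nonempty) subgraphs of $\mathcal G$ whose union is $\mathcal G$. The normalized cyclomatic quotient of the presentation is $$\hat\Xi = 1-n+\sup_{(\mathcal G_i)}\ \limsup_{i\to\infty}\ \xi(\mathcal G_i),$$ the supremum being over all exhausting chains. The group $G$ is called amenable if there is an invariant mean on the space of bounded complex-valued functions on $G$. Then $1-n\le\hat\Xi\le 1$. Moreover: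 (i) if $G$ is amenable, then $\hat\Xi=1/|G|$, where $1/|G|$ is read as $0$ when $G$ is infinite; (ii) if $G$ is non-amenable, then $1-n\le\hat\Xi<0$, and $\hat\Xi=1-n$ if and only if $n\ge 2$ and $G$ is a free group of rank $n$. -/

import Mathlib

open scoped ComplexOrder

noncomputable section

namespace CyclomaticQuotient

open CategoryTheory Filter

/-! ### Amenable groups -/

/-- The space `B(G)` of all bounded complex-valued functions on `G`. -/
def boundedFunctions (G : Type*) : Submodule ℂ (G → ℂ) where
  carrier := {f | ∃ C : ℝ, ∀ g, ‖f g‖ ≤ C}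
  zero_mem' := ⟨0, fun g => by simp⟩
  add_mem' := by
    rintro f₁ f₂ ⟨C₁, h₁⟩ ⟨C₂, h₂⟩
    exact ⟨C₁ + C₂, fun g => (norm_add_le _ _).trans (add_le_add (h₁ g) (h₂ g))⟩
  smul_mem' := by
    rintro c f ⟨C, h⟩
    refine ⟨‖c‖ * C, fun g => ?_⟩
    rw [Pi.smul_apply, norm_smul]
    exact mul_le_mul_of_nonneg_left (h g) (norm_nonneg c)

/-- The constant function `1` in `B(G)`. -/
def oneFunction (G : Type*) : boundedFunctions G :=
  ⟨fun _ => 1, 1, fun _ => by simp⟩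

/-- The left translate `h ↦ f (g * h)` of a bounded function. -/
def leftTranslate {G : Type*} [Group G] (g : G) (f : boundedFunctions G) : boundedFunctions G :=
  ⟨fun h => f.1 (g * h), f.2.imp fun _ hC h => hC (g * h)⟩

/-- A group is amenable if there is an invariant mean on `B(G)`: a linear functional which is
positive (it maps functions with values in `[0, ∞)` to `[0, ∞)`), normalized, and invariant
under translations. -/
def IsAmenable (G : Type*) [Group G] : Prop :=
  ∃ m : boundedFunctions G →ₗ[ℂ] ℂ,
    (∀ f : boundedFunctions G, (∀ g, 0 ≤ f.1 g) → 0 ≤ m f) ∧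
    m (oneFunction G) = 1 ∧
    ∀ (g : G) (f : boundedFunctions G), m (leftTranslate g f) = m f

/-! ### Subgraphs of the Cayley graph

For a group `G` with a finite family `x : Fin n → G`, the Cayley graph has vertex set `G` and
edge set `G × Fin n`, the edge `(g, j)` joining `g` to `g * x j`. So it may have loops and
multiple edges. -/

/-- A subgraph of the Cayley graph: a set of vertices and a set of edges containing the endpoints
of each of its edges. -/
structure CayleySubgraph {n : ℕ} {G : Type*} [Group G] (x : Fin n → G) where
  verts : Set G
  edges : Set (G × Fin n)
  source_mem : ∀ e ∈ edges, e.1 ∈ verts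
  target_mem : ∀ e ∈ edges, e.1 * x e.2 ∈ verts

namespace CayleySubgraph

variable {n : ℕ} {G : Type*} [Group G] {x : Fin n → G}

/-- The vertices of a subgraph, as a type. -/
structure Vertex (H : CayleySubgraph x) where
  val : G
  mem : val ∈ H.verts

/-- The edges of the subgraph, directed by the generators. -/
instance (H : CayleySubgraph x) : Quiver H.Vertex where
  Hom v w := {e : G × Fin n // e ∈ H.edges ∧ e.1 = v.val ∧ e.1 * x e.2 = w.val}

/-- Inclusion of subgraphs. -/
instance : LE (CayleySubgraph x) where
  le H K := H.verts ⊆ K.verts ∧ H.edges ⊆ K.edges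

/-- A subgraph is finite if it has finitely many vertices and edges. -/
def IsFinite (H : CayleySubgraph x) : Prop :=
  H.verts.Finite ∧ H.edges.Finite

/-- A subgraph is connected if it is nonempty and any two of its vertices are joined by a path in
it, where edges may be traversed in both directions. -/
def IsConnected (H : CayleySubgraph x) : Prop :=
  Nonempty H.Vertex ∧ ∀ v w : H.Vertex, Nonempty (@Quiver.Path (Quiver.Symmetrify H.Vertex) _ v w)

/-- The number of vertices. -/
def beta0 (H : CayleySubgraph x) : ℕ := H.verts.ncard

/-- The fundamental group of a subgraph at a vertex: homotopy classes of closed edge paths, i.e.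
the vertex group of the free groupoid generated by the edges. -/
abbrev FundamentalGroup (H : CayleySubgraph x) (v : H.Vertex) : Type _ :=
  End ((Quiver.FreeGroupoid.of H.Vertex).obj v)

end CayleySubgraph

/-- The rank of a free group of finite rank: the number of elements of a basis. -/
def freeRank (π : Type*) [Group π] : ℕ :=
  sInf {k : ℕ | Nonempty (π ≃* FreeGroup (Fin k))}

namespace CayleySubgraph

variable {n : ℕ} {G : Type*} [Group G] {x : Fin n → G}

/-- The cyclomatic number: the sum, over the components of the subgraph, of the rank of the
fundamental group of the component (based at some vertex of it). -/
def beta2 (H : CayleySubgraph x) : ℕ :=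
  ∑ᶠ c : Quiver.WeaklyConnectedComponent H.Vertex,
    freeRank (H.FundamentalGroup (@Quotient.out _ (Quiver.zigzagSetoid H.Vertex) c))

/-- The quotient of the cyclomatic number by the number of vertices. -/
def xi (H : CayleySubgraph x) : ℝ := (H.beta2 : ℝ) / (H.beta0 : ℝ)

end CayleySubgraph

/-- An exhausting chain: an increasing sequence of connected finite subgraphs whose union is the
whole Cayley graph. -/
structure IsExhaustingChain {n : ℕ} {G : Type*} [Group G] {x : Fin n → G}
    (C : ℕ → CayleySubgraph x) : Prop where
  finite : ∀ i, (C i).IsFinite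
  connected : ∀ i, (C i).IsConnected
  le_succ : ∀ i, C i ≤ C (i + 1)
  verts_exhaust : ∀ g : G, ∃ i, g ∈ (C i).verts
  edges_exhaust : ∀ e : G × Fin n, ∃ i, e ∈ (C i).edges

/-- The upper limit of `xi` along a chain, as an extended real. -/
def eta {n : ℕ} {G : Type*} [Group G] {x : Fin n → G} (C : ℕ → CayleySubgraph x) : EReal :=
  limsup (fun i => ((C i).xi : EReal)) atTop

/-- The cyclomatic quotient: the supremum of `eta` over all exhausting chains. It is taken in the
extended reals, so neither finiteness nor the existence of chains is built in. -/
def cyclomaticQuotient {n : ℕ} {G : Type*} [Group G] (x : Fin n → G) : EReal :=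
  ⨆ C : {C : ℕ → CayleySubgraph x // IsExhaustingChain C}, eta C.1

/-- The normalized cyclomatic quotient of the presentation `⟨x₁, …, xₙ | R⟩`. -/
def normalizedCyclomaticQuotient {n : ℕ} (R : Set (FreeGroup (Fin n))) : EReal :=
  ((1 - n : ℝ) : EReal) +
    cyclomaticQuotient (fun j : Fin n => (PresentedGroup.of j : PresentedGroup R))

end CyclomaticQuotient

end

/-!
For a finite connected subgraph with `v` vertices and `e` edges, the fundamental group is free of
rank `e - v + 1` (`CayleySubgraph.beta2_add_beta0`), so the quotient is
`ξ = e / v - 1 + 1 / v`. Everything is thereby reduced to the ratio `e / v`, which is at most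
`n`, and, when the group is infinite, the term `1 / v` vanishes along every exhausting chain.
Euler's formula itself is obtained by counting the functors from the free groupoid to the group of
order two: they are arbitrary labellings of the edges, and they are also given by a homomorphism
on the vertex group together with arbitrary values on arrows from the base vertex to the other
`v - 1` vertices (`functorEquivProd`).

The proportion `e / (n v)` is close to `1` exactly for Følner sets. An invariant mean produces
Følner sets (`exists_folner_of_isAmenable`): otherwise all finite sets expand, Hall's marriage
theorem gives a paradoxical decomposition, and the mean of the constant `1` would be at least `2`.
Conversely, limits of averages over Følner sets are invariant means (`isAmenable_of_folner`).
A Følner set of least size is connected, and in an infinite group Følner sets are large, so they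
can be glued to an exhausting chain with `e / v → n` (`exists_folner_chain`). This settles the
amenable case; in the non-amenable case `e / v` stays below `n - ε`.

If the generators satisfy a nontrivial relation, a shortest one is a circuit which traverses its
first edge only once (`exists_bypassed_edge`). A ball contains translates of this edge, in number
proportional to the size of the ball, which can be removed at the same time without disconnecting
the ball (`card_add_card_le_of_separated`), so `ξ` is bounded below along the chain of balls. If on
the other hand the generators are a free basis, the Cayley graph is a tree and `e ≤ v`. Finally, `n`
generators of a free group of rank `n` are a basis because finitely generated free groups are
Hopfian (`freeGroup_injective_of_surjective`), which follows from residual finiteness.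
-/

open scoped ComplexOrder

noncomputable section

namespace CyclomaticQuotient

open CategoryTheory Filter

universe u

/-! ### Euler's formula for the fundamental group -/

section Groupoid

variable {V : Type u} [Quiver.{u} V]

/-- Functors from a free groupoid to a group correspond to labellings of the generating arrows. -/
def functorEquivLabelling (X : Type u) [Group X] :
    (Quiver.FreeGroupoid V ⥤ SingleObj X) ≃ Quiver.Labelling V X where
  toFun F := fun _ _ e => F.map ((Quiver.FreeGroupoid.of V).map e)
  invFun f := Quiver.FreeGroupoid.lift ⟨fun _ => SingleObj.star X, fun {_ _} e => f e⟩
  left_inv F := by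
    symm
    apply Quiver.FreeGroupoid.lift_unique
    rfl
  right_inv f := by
    let φ : V ⥤q SingleObj X := ⟨fun _ => SingleObj.star X, fun {_ _} e => f e⟩
    have hs := Quiver.FreeGroupoid.lift_spec φ
    funext a b e
    have := Prefunctor.congr_hom hs e
    simpa using! this

/-- The free groupoid on a quiver is free in the sense of `IsFreeGroupoid`, with the arrows of the
quiver as generators. -/
instance freeGroupoidIsFree : IsFreeGroupoid (Quiver.FreeGroupoid V) where
  quiverGenerators := ⟨fun a b => @Quiver.Hom V _ a.as b.as⟩
  of := fun {a b} e => (Quiver.FreeGroupoid.of V).map (X := a.as) (Y := b.as) e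
  unique_lift := by
    intro X _ f
    let f' : Quiver.Labelling V X := fun a b e => f (a := ⟨a⟩) (b := ⟨b⟩) e
    refine ⟨(functorEquivLabelling X).symm f', ?_, ?_⟩
    · rintro ⟨a⟩ ⟨b⟩ e
      exact congrFun (congrFun (congrFun ((functorEquivLabelling X).apply_symm_apply f') a) b) e
    · intro F hF
      rw [Equiv.eq_symm_apply]
      funext a b e
      exact hF ⟨a⟩ ⟨b⟩ e

end Groupoid

section Gauge

variable {𝒢 : Type u} [Groupoid.{u} 𝒢]

theorem functor_singleObj_ext {X : Type u} [Group X] {F F' : 𝒢 ⥤ SingleObj X}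
    (h : ∀ {a b : 𝒢} (f : a ⟶ b), (F.map f : X) = (F'.map f : X)) : F = F' :=
  CategoryTheory.Functor.hext (fun _ => rfl) fun _ _ f => heq_of_eq (h f)

open Classical in
/-- A functor from a connected groupoid to a group is determined by its restriction to a vertex
group and by its values on one arrow from the base vertex to each other vertex, and these can be
prescribed arbitrarily. -/
def functorEquivProd (r : 𝒢) (p : ∀ a, r ⟶ a) (hp : p r = 𝟙 r) (X : Type u) [Group X] :
    (𝒢 ⥤ SingleObj X) ≃ (End r →* X) × ({a : 𝒢 // a ≠ r} → X) where
  toFun F := (⟨⟨fun f => (F.map f : X), F.map_id r⟩, fun f g => by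
      exact F.map_comp g f⟩, fun a => F.map (p a.1))
  invFun φ :=
    let c : 𝒢 → X := fun a => if h : a = r then 1 else φ.2 ⟨a, h⟩
    { obj := fun _ => SingleObj.star X
      map := fun {a b} f => (c b * φ.1 (p a ≫ f ≫ inv (p b)) * (c a)⁻¹ : X)
      map_id := fun a => by
        have h1 : φ.1 (p a ≫ 𝟙 a ≫ inv (p a)) = 1 := by
          rw [Category.id_comp, IsIso.hom_inv_id]; exact φ.1.map_one
        have key : ∀ y z : X, y = 1 → z * y * z⁻¹ = 1 := by rintro y z rfl; group
        exact key _ _ h1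
      map_comp := fun {a b d} f g => by
        have h1 : φ.1 (p a ≫ (f ≫ g) ≫ inv (p d)) =
            φ.1 (p b ≫ g ≫ inv (p d)) * φ.1 (p a ≫ f ≫ inv (p b)) := by
          rw [← φ.1.map_mul, End.mul_def]
          congr 1
          simp only [Category.assoc, IsIso.inv_hom_id_assoc]
        have key : ∀ t y z : X, t = y * z →
            c d * t * (c a)⁻¹ = (c d * y * (c b)⁻¹) * (c b * z * (c a)⁻¹) := by
          rintro t y z rfl; group
        exact key _ _ _ h1 }
  left_inv F := by
    have hc : ∀ a : 𝒢, (if h : a = r then (1 : X) else F.map (p a)) = F.map (p a) := by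
      intro a
      split_ifs with h
      · subst h
        rw [hp, F.map_id]; rfl
      · rfl
    refine functor_singleObj_ext fun {a b} f => ?_
    have h1 : (F.map (p a ≫ f ≫ inv (p b)) : X) =
        (F.map (p b) : X)⁻¹ * (F.map f : X) * (F.map (p a) : X) := by
      rw [F.map_comp, F.map_comp, F.map_inv]
      simp only [SingleObj.comp_as_mul, SingleObj.inv_as_inv]
    have key : ∀ s t y z : X, s = t⁻¹ * y * z → t * s * z⁻¹ = y := by
      rintro s t y z rfl; group
    refine Eq.trans ?_ (key _ _ _ _ h1)
    change (if h : b = r then (1 : X) else F.map (p b)) * _ *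
      (if h : a = r then (1 : X) else F.map (p a))⁻¹ = _
    rw [hc, hc]
    rfl
  right_inv φ := by
    refine Prod.ext ?_ ?_
    · ext f
      change (if h : r = r then (1 : X) else φ.2 ⟨r, h⟩) * φ.1 (p r ≫ f ≫ inv (p r)) *
        (if h : r = r then (1 : X) else φ.2 ⟨r, h⟩)⁻¹ = φ.1 f
      rw [dif_pos rfl, one_mul, inv_one, mul_one, hp]
      congr 1
      simp
    · funext a
      change (if h : a.1 = r then (1 : X) else φ.2 ⟨a.1, h⟩) *
        φ.1 (p r ≫ p a.1 ≫ inv (p a.1)) *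
        (if h : r = r then (1 : X) else φ.2 ⟨r, h⟩)⁻¹ = φ.2 a
      have h1 : φ.1 (p r ≫ p a.1 ≫ inv (p a.1)) = 1 := by
        rw [IsIso.hom_inv_id, hp, Category.comp_id]; exact φ.1.map_one
      rw [dif_pos rfl, dif_neg a.2, h1]
      simp

end Gauge

/-- The rank of a free group can be read off from the number of its homomorphisms to the group of
order two. -/
theorem exists_equiv_freeGroup_of_card_hom {π : Type u} [Group π] [IsFreeGroup π] (k : ℕ)
    (h : Nat.card (π →* ULift.{u} (Multiplicative (ZMod 2))) = 2 ^ k) :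
    Nonempty (π ≃* FreeGroup (Fin k)) := by
  set X := ULift.{u} (Multiplicative (ZMod 2))
  have hX : Nat.card X = 2 := by simp [X]
  have : Finite X := Nat.finite_of_card_ne_zero (by omega)
  have : Nontrivial X := by
    rw [← Finite.one_lt_card_iff_nontrivial]; omega
  let ι := IsFreeGroup.Generators π
  have e : (ι → X) ≃ (π →* X) := IsFreeGroup.lift
  rw [← Nat.card_congr e] at h
  have hfin : Finite (ι → X) := Nat.finite_of_card_ne_zero (by rw [h]; positivity)
  have : Finite ι := by
    classical
    obtain ⟨a, b, hab⟩ := exists_pair_ne X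
    refine Finite.of_injective (fun i : ι => fun j : ι => if i = j then a else b) ?_
    intro i j hij
    by_contra hne
    have := congrFun hij i
    simp only [if_true] at this
    rw [if_neg (Ne.symm hne)] at this
    exact hab this
  rw [Nat.card_fun, hX] at h
  have hk : Nat.card ι = k := Nat.pow_right_injective le_rfl h
  exact ⟨(IsFreeGroup.toFreeGroup π).trans
    (FreeGroup.freeGroupCongr ((Finite.equivFin ι).trans (finCongr hk)))⟩

theorem freeRank_eq {π : Type*} [Group π] {k : ℕ} (h : Nonempty (π ≃* FreeGroup (Fin k))) :
    freeRank π = k := by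
  obtain ⟨e⟩ := h
  have : {k : ℕ | Nonempty (π ≃* FreeGroup (Fin k))} = {k} := by
    ext l
    simp only [Set.mem_ofPred_eq, Set.mem_singleton_iff]
    constructor
    · rintro ⟨e'⟩
      simpa using Fintype.card_congr (Equiv.ofFreeGroupEquiv (e'.symm.trans e))
    · rintro rfl
      exact ⟨e⟩
  rw [freeRank, this, csInf_singleton]

namespace CayleySubgraph

variable {n : ℕ} {G : Type u} [Group G] {x : Fin n → G}

/-- Labellings of the quiver of a subgraph are functions on its set of edges. -/
def labellingEquiv (H : CayleySubgraph x) (X : Type u) :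
    Quiver.Labelling H.Vertex X ≃ (H.edges → X) where
  toFun f e := f (a := ⟨e.1.1, H.source_mem _ e.2⟩) (b := ⟨e.1.1 * x e.1.2, H.target_mem _ e.2⟩)
    ⟨e.1, e.2, rfl, rfl⟩
  invFun c := fun _ _ e => c ⟨e.1, e.2.1⟩
  left_inv f := by
    funext ⟨a, ha⟩ ⟨b, hb⟩ ⟨⟨g, j⟩, he, h1, h2⟩
    dsimp only at h1 h2
    subst h1 h2
    rfl
  right_inv c := rfl

/-- Vertices of a subgraph as elements of its set of vertices. -/
def vertexEquiv (H : CayleySubgraph x) : H.Vertex ≃ H.verts where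
  toFun v := ⟨v.val, v.mem⟩
  invFun v := ⟨v.1, v.2⟩
  left_inv _ := rfl
  right_inv _ := rfl

/-- **Euler's formula**: a finite connected graph with `v` vertices and `e` edges has
fundamental group free of rank `e - v + 1`. -/
theorem beta2_add_beta0 (H : CayleySubgraph x) (hf : H.IsFinite) (hc : H.IsConnected) :
    H.beta2 + H.beta0 = H.edges.ncard + 1 := by
  obtain ⟨⟨v₀⟩, hpath⟩ := hc
  have hV : Finite H.verts := hf.1
  have hE : Finite H.edges := hf.2
  set 𝒢 := Quiver.FreeGroupoid H.Vertex
  -- there is only one component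
  have huniq : ∀ c c' : Quiver.WeaklyConnectedComponent H.Vertex, c = c' := by
    intro c c'
    induction c using Quotient.inductionOn
    induction c' using Quotient.inductionOn
    exact Quotient.sound (hpath _ _)
  let c₀ : Quiver.WeaklyConnectedComponent H.Vertex := Quiver.WeaklyConnectedComponent.mk v₀
  let v := @Quotient.out _ (Quiver.zigzagSetoid H.Vertex) c₀
  have hb2 : H.beta2 = freeRank (H.FundamentalGroup v) := by
    rw [beta2, finsum_eq_single _ c₀ (fun c h => absurd (huniq c c₀) h)]
  let r : 𝒢 := (Quiver.FreeGroupoid.of H.Vertex).obj v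
  have hhom : ∀ a b : 𝒢, Nonempty (a ⟶ b) := by
    rintro ⟨a⟩ ⟨b⟩
    obtain ⟨q⟩ := hpath a b
    exact ⟨Quot.mk _ q⟩
  have hconn : CategoryTheory.IsConnected 𝒢 := by
    have : Nonempty 𝒢 := ⟨r⟩
    exact zigzag_isConnected fun a b => Relation.ReflTransGen.single (Or.inl (hhom a b))
  have hfree : IsFreeGroup (End r) := IsFreeGroupoid.endIsFreeOfConnectedFree r
  classical
  let p : ∀ a : 𝒢, r ⟶ a := fun a => if h : r = a then eqToHom h else (hhom r a).some
  have hp : p r = 𝟙 r := by simp [p]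
  set X := ULift.{u} (Multiplicative (ZMod 2))
  have hX : Nat.card X = 2 := by simp [X]
  have e1 := ((functorEquivProd r p hp X).symm.trans (functorEquivLabelling X)).trans
    (H.labellingEquiv X)
  have e2 : 𝒢 ≃ H.verts := (Equiv.mk (fun a : 𝒢 => a.as) (fun a => ⟨a⟩)
    (fun _ => rfl) (fun _ => rfl) : 𝒢 ≃ H.Vertex).trans H.vertexEquiv
  have : Finite 𝒢 := Finite.of_equiv _ e2.symm
  have hcard := Nat.card_congr e1
  rw [Nat.card_prod, Nat.card_fun, Nat.card_fun, hX] at hcard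
  have hV' : Nat.card {a : 𝒢 // a ≠ r} + 1 = H.beta0 := by
    have h1 : Nat.card 𝒢 = H.beta0 := Nat.card_congr e2
    have h2 := Set.ncard_compl ({r} : Set 𝒢)
    have h3 := Finite.card_pos_iff.mpr ⟨r⟩
    rw [Set.ncard_singleton] at h2
    have h4 : Nat.card {a : 𝒢 // a ≠ r} = ({r}ᶜ : Set 𝒢).ncard := rfl
    omega
  have hE' : Nat.card H.edges = H.edges.ncard := rfl
  have hdvd : Nat.card (End r →* X) ∣ 2 ^ Nat.card H.edges := ⟨_, hcard.symm⟩
  obtain ⟨k, -, hk⟩ := (Nat.dvd_prime_pow Nat.prime_two).1 hdvd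
  rw [hk, ← pow_add] at hcard
  have := Nat.pow_right_injective le_rfl hcard
  rw [hb2, freeRank_eq (exists_equiv_freeGroup_of_card_hom k hk)]
  omega

end CayleySubgraph

/-! ### Amenability and Følner sets -/

section Folner

variable {n : ℕ} {G : Type u} [Group G]

open Classical in
/-- The edges of the Cayley graph with both endpoints in a finite set `F` of vertices. -/
def inducedEdges (x : Fin n → G) (F : Finset G) : Finset (G × Fin n) :=
  (F ×ˢ Finset.univ).filter fun e => e.1 * x e.2 ∈ F

theorem mem_inducedEdges {x : Fin n → G} {F : Finset G} {e : G × Fin n} :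
    e ∈ inducedEdges x F ↔ e.1 ∈ F ∧ e.1 * x e.2 ∈ F := by
  simp [inducedEdges]

open Classical in
theorem card_inducedEdges_add (x : Fin n → G) (F : Finset G) :
    (inducedEdges x F).card +
      ((F ×ˢ Finset.univ).filter fun e : G × Fin n => e.1 * x e.2 ∉ F).card = n * F.card := by
  rw [inducedEdges, Finset.card_filter_add_card_filter_not, Finset.card_product]
  simp [mul_comm]

theorem card_inducedEdges_le (x : Fin n → G) (F : Finset G) :
    (inducedEdges x F).card ≤ n * F.card := by
  rw [← card_inducedEdges_add x F]
  exact Nat.le_add_right _ _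

open Classical in
theorem card_filter_add_card_inducedEdges_le (x : Fin n → G) (F : Finset G) (j : Fin n) :
    (F.filter fun g => g * x j ∉ F).card + (inducedEdges x F).card ≤ n * F.card := by
  rw [← card_inducedEdges_add x F, add_comm]
  gcongr 1
  refine Finset.card_le_card_of_injOn (fun g => (g, j)) ?_ ?_
  · intro g hg
    simpa using hg
  · intro a _ b _ h
    exact congrArg Prod.fst h

open Classical in
theorem norm_sum_translate_sub_le (x : Fin n → G) (F : Finset G) (j : Fin n) (f : G → ℂ) (C : ℝ)
    (hf : ∀ g, ‖f g‖ ≤ C) :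
    ‖∑ h ∈ F, f (h * x j) - ∑ h ∈ F, f h‖ ≤ 2 * C * (n * F.card - (inducedEdges x F).card) := by
  have hinj : Function.Injective fun h : G => h * x j := mul_left_injective _
  have hC : 0 ≤ C := (norm_nonneg _).trans (hf 1)
  set F' := F.image fun h => h * x j
  have h1 : ∑ h ∈ F, f (h * x j) = ∑ h ∈ F', f h := by
    rw [Finset.sum_image hinj.injOn]
  have hcard : F'.card = F.card := Finset.card_image_of_injective _ hinj
  have h2 : (F' \ F).card ≤ (F.filter fun g => g * x j ∉ F).card := by
    refine (Finset.card_le_card ?_).trans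
      (Finset.card_image_le (f := fun h => h * x j) (s := F.filter fun g => g * x j ∉ F))
    intro g hg
    obtain ⟨hg1, hg2⟩ := Finset.mem_sdiff.1 hg
    obtain ⟨h, hh, rfl⟩ := Finset.mem_image.1 hg1
    exact Finset.mem_image.2 ⟨h, Finset.mem_filter.2 ⟨hh, hg2⟩, rfl⟩
  have h3 : (F \ F').card = (F' \ F).card := Finset.card_sdiff_comm hcard.symm
  have h4 : ((F.filter fun g => g * x j ∉ F).card : ℝ) + (inducedEdges x F).card ≤ n * F.card := by
    exact_mod_cast card_filter_add_card_inducedEdges_le x F j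
  have h2' : ((F' \ F).card : ℝ) ≤ (F.filter fun g => g * x j ∉ F).card := by exact_mod_cast h2
  have hb : ∀ s : Finset G, ‖∑ h ∈ s, f h‖ ≤ s.card * C := fun s =>
    (norm_sum_le_of_le _ fun h _ => hf h).trans (by simp)
  rw [h1, ← Finset.sum_sdiff_sub_sum_sdiff]
  calc ‖∑ h ∈ F' \ F, f h - ∑ h ∈ F \ F', f h‖
      ≤ (F' \ F).card * C + (F \ F').card * C := (norm_sub_le _ _).trans (add_le_add (hb _) (hb _))
    _ = 2 * C * (F' \ F).card := by rw [h3]; ring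
    _ ≤ _ := by gcongr; linarith

/-- Averages over a sequence of Følner sets converge, along an ultrafilter, to an invariant
mean. The sets are inverted because a mean is required to be invariant under left translations,
while the edges of the Cayley graph are right translations. -/
theorem isAmenable_of_folner (x : Fin n → G) (hx : Subgroup.closure (Set.range x) = ⊤)
    (h : ∀ ε : ℝ, 0 < ε → ∃ F : Finset G, F.Nonempty ∧
      (n - ε) * F.card ≤ (inducedEdges x F).card) : IsAmenable G := by
  classical
  choose F hF hcard using fun k : ℕ => h (1 / (k + 1)) Nat.one_div_pos_of_nat
  have hpos : ∀ k, (0 : ℝ) < (F k).card := fun k => by exact_mod_cast (hF k).card_pos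
  let A : ℕ → boundedFunctions G → ℂ := fun k f => (∑ h ∈ F k, f.1 h⁻¹) / ((F k).card : ℂ)
  have hbound : ∀ (f : boundedFunctions G) (C : ℝ), (∀ g, ‖f.1 g‖ ≤ C) → ∀ k, ‖A k f‖ ≤ C := by
    intro f C hC k
    simp only [A, norm_div, Complex.norm_natCast]
    rw [div_le_iff₀ (hpos k), mul_comm]
    exact (norm_sum_le_of_le _ fun h _ => hC _).trans (by simp)
  have hlim : ∀ f : boundedFunctions G, ∃ z, Tendsto (fun k => A k f) (hyperfilter ℕ) (nhds z) := by
    intro f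
    obtain ⟨C, hC⟩ := f.2
    have := (isCompact_closedBall (0 : ℂ) C).ultrafilter_le_nhds
      ((hyperfilter ℕ).map fun k => A k f) (by
        rw [le_principal_iff]
        exact Filter.mem_map.2 (univ_mem' fun k => by simpa using hbound f C hC k))
    obtain ⟨z, -, hz⟩ := this
    exact ⟨z, hz⟩
  choose m hm using hlim
  have huniq : ∀ {f : boundedFunctions G} {z : ℂ},
      Tendsto (fun k => A k f) (hyperfilter ℕ) (nhds z) → m f = z :=
    fun h => tendsto_nhds_unique (hm _) h
  let M : boundedFunctions G →ₗ[ℂ] ℂ :=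
    { toFun := m
      map_add' := fun f₁ f₂ => huniq <| by
        refine ((hm f₁).add (hm f₂)).congr fun k => ?_
        simp only [A, Submodule.coe_add, Pi.add_apply, Finset.sum_add_distrib, add_div]
      map_smul' := fun c f => huniq <| by
        refine ((hm f).const_mul c).congr fun k => ?_
        simp only [A, Submodule.coe_smul, Pi.smul_apply, smul_eq_mul, ← Finset.mul_sum,
          mul_div_assoc] }
  refine ⟨M, ?_, ?_, ?_⟩
  · intro f hf
    refine ge_of_tendsto' (hm f) fun k => ?_
    exact div_nonneg (Finset.sum_nonneg fun h _ => hf _) (by positivity)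
  · refine huniq (tendsto_const_nhds.congr fun k => ?_)
    have : ((F k).card : ℂ) ≠ 0 := by exact_mod_cast (hpos k).ne'
    simp [A, oneFunction, this]
  · have hgen : ∀ (j : Fin n) (f : boundedFunctions G), m (leftTranslate (x j)⁻¹ f) = m f := by
      intro j f
      obtain ⟨C, hC⟩ := f.2
      have hC0 : 0 ≤ C := (norm_nonneg _).trans (hC 1)
      have hdiff : Tendsto (fun k => A k (leftTranslate (x j)⁻¹ f) - A k f) atTop (nhds 0) := by
        have hbd : ∀ k, ‖A k (leftTranslate (x j)⁻¹ f) - A k f‖ ≤ 2 * C * (1 / ((k : ℝ) + 1)) := by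
          intro k
          have h1 := norm_sum_translate_sub_le x (F k) j (fun h => f.1 h⁻¹) C fun g => hC _
          have h2 : A k (leftTranslate (x j)⁻¹ f) - A k f =
              (∑ h ∈ F k, f.1 (h * x j)⁻¹ - ∑ h ∈ F k, f.1 h⁻¹) / ((F k).card : ℂ) := by
            simp only [A, leftTranslate, sub_div, mul_inv_rev]
          rw [h2, norm_div, Complex.norm_natCast, div_le_iff₀ (hpos k)]
          refine h1.trans ?_
          have h3 := hcard k
          rw [mul_assoc (2 * C)]
          gcongr
          linarith
        refine squeeze_zero_norm hbd ?_
        simpa using tendsto_one_div_add_atTop_nhds_zero_nat.const_mul (2 * C)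
      have := (hm f).add (hdiff.mono_left Nat.hyperfilter_le_atTop)
      rw [add_zero] at this
      exact huniq (this.congr fun k => by ring)
    have htr : ∀ (g h : G) (f : boundedFunctions G),
        leftTranslate (g * h) f = leftTranslate h (leftTranslate g f) := fun g h f =>
      Subtype.ext (funext fun k => by simp [leftTranslate, mul_assoc])
    have h1 : ∀ f : boundedFunctions G, leftTranslate 1 f = f := fun f =>
      Subtype.ext (funext fun k => by simp [leftTranslate])
    intro g f
    have hg : g ∈ Subgroup.closure (Set.range x) := by rw [hx]; trivial
    change m _ = m _
    induction hg using Subgroup.closure_induction generalizing f with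
    | mem g hg =>
      obtain ⟨j, rfl⟩ := hg
      rw [← hgen j, ← htr, mul_inv_cancel, h1]
    | one => rw [h1]
    | mul a b _ _ ha hb => rw [htr, hb, ha]
    | inv a _ ha => rw [← ha, ← htr, inv_mul_cancel, h1]

open scoped Pointwise in
open Classical in
/-- The isoperimetric inequality turns into expansion under multiplication by the generators. -/
theorem card_mul_generators_ge (x : Fin n → G) (F : Finset G) (ε : ℝ)
    (h : ((inducedEdges x F).card : ℝ) ≤ (n - ε) * F.card) (hn : 0 < n) :
    (1 + ε / n) * F.card ≤ (F * insert 1 (Finset.univ.image x)).card := by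
  set S : Finset G := insert 1 (Finset.univ.image x)
  have hsub : F ⊆ F * S := fun g hg => by
    simpa using Finset.mul_mem_mul hg (Finset.mem_insert_self 1 (Finset.univ.image x))
  have h1 : ((F ×ˢ Finset.univ).filter fun e : G × Fin n => e.1 * x e.2 ∉ F).card ≤
      ((F * S) \ F).card * n := by
    have : (((F * S) \ F) ×ˢ (Finset.univ : Finset (Fin n))).card = ((F * S) \ F).card * n := by
      rw [Finset.card_product, Finset.card_univ, Fintype.card_fin]
    rw [← this]
    refine Finset.card_le_card_of_injOn (fun e => (e.1 * x e.2, e.2)) ?_ ?_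
    · rintro ⟨g, j⟩ hg
      simp only [Finset.coe_filter, Finset.mem_product, Finset.mem_univ, and_true,
        Set.mem_ofPred_eq] at hg
      simp only [Finset.coe_product, Set.mem_prod, Finset.mem_coe, Finset.mem_sdiff,
        Finset.mem_univ, and_true]
      exact ⟨Finset.mul_mem_mul hg.1 (by simp [S]), hg.2⟩
    · rintro ⟨g, j⟩ - ⟨g', j'⟩ - h
      simp only [Prod.mk.injEq] at h
      obtain ⟨h1, rfl⟩ := h
      simpa using h1
  have h2 := card_inducedEdges_add x F
  have h3 := Finset.card_sdiff_add_card_eq_card hsub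
  have h1' : (((F ×ˢ Finset.univ).filter fun e : G × Fin n => e.1 * x e.2 ∉ F).card : ℝ) ≤
      ((F * S) \ F).card * n := by exact_mod_cast h1
  have h2' : ((inducedEdges x F).card : ℝ) + (((F ×ˢ Finset.univ).filter
      fun e : G × Fin n => e.1 * x e.2 ∉ F).card : ℝ) = n * F.card := by exact_mod_cast h2
  have h3' : (((F * S) \ F).card : ℝ) + F.card = (F * S).card := by exact_mod_cast h3
  have hn' : (0 : ℝ) < n := by exact_mod_cast hn
  have : ε * F.card / n ≤ ((F * S) \ F).card := by
    rw [div_le_iff₀ hn']; linarith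
  calc (1 + ε / n) * F.card = F.card + ε * F.card / n := by ring
    _ ≤ _ := by linarith

open scoped Pointwise in
/-- If every finite set doubles under right multiplication by a fixed finite set, then Hall's
marriage theorem yields a paradoxical decomposition, which contradicts the existence of an
invariant mean. -/
theorem not_isAmenable_of_doubling [DecidableEq G] (T : Finset G)
    (hT : ∀ F : Finset G, 2 * F.card ≤ (F * T).card) : ¬ IsAmenable G := by
  rintro ⟨m, hpos, hone, hinv⟩
  -- an injection `G × Bool → G` moving the first coordinate by elements of `T`
  obtain ⟨f, hf, hfT⟩ : ∃ f : G × Bool → G, Function.Injective f ∧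
      ∀ p, f p ∈ T.image fun t => p.1 * t := by
    refine (Finset.all_card_le_biUnion_card_iff_exists_injective
      (fun p : G × Bool => T.image fun t => p.1 * t)).1 fun s => ?_
    calc s.card ≤ ((s.image Prod.fst) ×ˢ (Finset.univ : Finset Bool)).card := by
          refine Finset.card_le_card fun p hp => ?_
          simp only [Finset.mem_product, Finset.mem_univ, and_true]
          exact Finset.mem_image_of_mem _ hp
      _ = 2 * (s.image Prod.fst).card := by
          rw [Finset.card_product, Finset.card_univ, Fintype.card_bool, mul_comm]
      _ ≤ _ := hT _
      _ ≤ _ := by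
          refine Finset.card_le_card fun g hg => ?_
          obtain ⟨a, ha, t, ht, rfl⟩ := Finset.mem_mul.1 hg
          obtain ⟨p, hp, rfl⟩ := Finset.mem_image.1 ha
          exact Finset.mem_biUnion.2 ⟨p, hp, Finset.mem_image_of_mem _ ht⟩
  -- the indicator of the set of `g⁻¹` for which `(g, b)` is moved by `t`
  let φ : Bool → G → boundedFunctions G := fun b t =>
    ⟨fun h => if f (h⁻¹, b) = h⁻¹ * t then 1 else 0, 1, fun h => by dsimp only; split_ifs <;> simp⟩
  have hsum : ∀ b, ∑ t ∈ T, φ b t = oneFunction G := by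
    intro b
    apply Subtype.ext
    funext h
    rw [Submodule.coe_sum, Finset.sum_apply]
    obtain ⟨t, ht, hft⟩ := Finset.mem_image.1 (hfT (h⁻¹, b))
    rw [Finset.sum_eq_single_of_mem t ht]
    · simp only [φ, oneFunction]
      rw [if_pos hft.symm]
    · intro t' _ hne
      simp only [φ]
      rw [if_neg]
      rw [← hft]
      exact fun h' => hne (mul_left_cancel h').symm
  -- translating back, the images of `f` are disjoint, so two copies of `1` fit below `1`
  let D : boundedFunctions G :=
    oneFunction G - ∑ b : Bool, ∑ t ∈ T, leftTranslate t (φ b t)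
  have hD : ∀ h, 0 ≤ D.1 h := by
    intro h
    have hval : ∑ p ∈ (Finset.univ : Finset Bool) ×ˢ T,
        (if f (h⁻¹ * p.2⁻¹, p.1) = h⁻¹ then (1 : ℂ) else 0) ≤ 1 := by
      rw [Finset.sum_boole]
      have : (((Finset.univ : Finset Bool) ×ˢ T).filter
          fun p => f (h⁻¹ * p.2⁻¹, p.1) = h⁻¹).card ≤ 1 := by
        rw [Finset.card_le_one]
        rintro ⟨b, t⟩ hp ⟨b', t'⟩ hp'
        have h1 := (Finset.mem_filter.1 hp).2
        have h2 := (Finset.mem_filter.1 hp').2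
        have := hf (h1.trans h2.symm)
        simp only [Prod.mk.injEq, mul_right_inj, inv_inj] at this
        rw [this.1, this.2]
      exact_mod_cast this
    have : D.1 h = 1 - ∑ p ∈ (Finset.univ : Finset Bool) ×ˢ T,
        (if f (h⁻¹ * p.2⁻¹, p.1) = h⁻¹ then (1 : ℂ) else 0) := by
      rw [Finset.sum_product]
      simp only [D, Submodule.coe_sub, Submodule.coe_sum, Pi.sub_apply, Finset.sum_apply,
        leftTranslate, φ, oneFunction, mul_inv_rev, inv_mul_cancel_right]
    rw [this]
    exact sub_nonneg.2 hval
  have h0 := hpos D hD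
  have h1 : m D = -1 := by
    simp only [D, map_sub, map_sum, hinv, hone]
    simp only [← map_sum, hsum]
    simp [hone]
    norm_num
  rw [h1] at h0
  norm_num [Complex.le_def] at h0

/-- **Følner's condition**: in an amenable group there are finite sets of vertices for which the
proportion of the edges leaving the set is arbitrarily small. -/
theorem exists_folner_of_isAmenable (x : Fin n → G) (hG : IsAmenable G) (ε : ℝ) (hε : 0 < ε) :
    ∃ F : Finset G, F.Nonempty ∧ (n - ε) * F.card ≤ (inducedEdges x F).card := by
  classical
  by_contra! hcon
  have hall : ∀ F : Finset G, ((inducedEdges x F).card : ℝ) ≤ (n - ε) * F.card := by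
    intro F
    rcases F.eq_empty_or_nonempty with rfl | hF
    · simp [inducedEdges]
    · exact (hcon F hF).le
  have hn : 0 < n := by
    rcases Nat.eq_zero_or_pos n with rfl | h
    · have := hcon {1} (Finset.singleton_nonempty 1)
      simp only [Finset.card_singleton] at this
      have h0 : (0 : ℝ) ≤ (inducedEdges x {1}).card := by positivity
      push_cast at this
      linarith
    · exact h
  have hn' : (0 : ℝ) < n := by exact_mod_cast hn
  set S : Finset G := insert 1 (Finset.univ.image x) with hS
  open scoped Pointwise in
  have hpow : ∀ (k : ℕ) (F : Finset G), (1 + ε / n) ^ k * F.card ≤ (F * S ^ k).card := by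
    intro k F
    induction k with
    | zero => simp
    | succ k ih =>
      rw [pow_succ, pow_succ, ← mul_assoc]
      have := card_mul_generators_ge x (F * S ^ k) ε (hall _) hn
      refine le_trans ?_ this
      have : 0 ≤ 1 + ε / n := by positivity
      calc (1 + ε / n) ^ k * (1 + ε / n) * F.card = (1 + ε / n) * ((1 + ε / n) ^ k * F.card) := by
            ring
        _ ≤ _ := by gcongr
  obtain ⟨k, hk⟩ := pow_unbounded_of_one_lt 2 (show 1 < 1 + ε / n by
    have : 0 < ε / n := by positivity
    linarith)
  open scoped Pointwise in
  refine not_isAmenable_of_doubling (S ^ k) (fun F => ?_) hG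
  have : (2 : ℝ) * F.card ≤ (F * S ^ k).card :=
    le_trans (by gcongr) (hpow k F)
  exact_mod_cast this

end Folner

/-! ### Free groups are residually finite and Hopfian -/

section Hopf

variable {α : Type u}

/-- For a finite set `s` of group elements, left multiplication by `a`, where it does not
leave `s`, extends to a permutation of `s`. -/
theorem exists_perm_extending_mul {F : Type u} [Group F] (s : Finset F) (a : F) :
    ∃ σ : Equiv.Perm s, ∀ (g : s) (h : a * g.1 ∈ s), σ g = ⟨a * g.1, h⟩ := by
  classical
  let e : {g : s // a * g.1 ∈ s} ≃ {g : s // a⁻¹ * g.1 ∈ s} :=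
    { toFun := fun g => ⟨⟨a * g.1.1, g.2⟩, by simp⟩
      invFun := fun g => ⟨⟨a⁻¹ * g.1.1, g.2⟩, by simp⟩
      left_inv := fun g => by simp
      right_inv := fun g => by simp }
  exact ⟨e.extendSubtype, fun g h => e.extendSubtype_apply_of_mem g h⟩

/-- A nontrivial element of a free group acts nontrivially in some finite permutation
representation: the letters act on the finite set of suffixes of a word by left multiplication,
as far as it goes, and then the word moves the empty suffix to the whole word. -/
theorem exists_perm_hom_ne_one (w : FreeGroup α) (hw : w ≠ 1) :
    ∃ (s : Finset (FreeGroup α)) (ρ : FreeGroup α →* Equiv.Perm s), ρ w ≠ 1 := by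
  classical
  let s : Finset (FreeGroup α) := (w.toWord.tails.map FreeGroup.mk).toFinset
  have hs : ∀ L : List (α × Bool), L <:+ w.toWord → FreeGroup.mk L ∈ s := by
    intro L hL
    simp only [s, List.mem_toFinset, List.mem_map, List.mem_tails]
    exact ⟨L, hL, rfl⟩
  choose σ hσ using fun a : α => exists_perm_extending_mul s (FreeGroup.of a)
  refine ⟨s, FreeGroup.lift σ, fun h => hw ?_⟩
  have hone : (1 : FreeGroup α) ∈ s := hs [] (List.nil_suffix)
  have key : ∀ (L : List (α × Bool)) (hL : L <:+ w.toWord),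
      FreeGroup.lift σ (FreeGroup.mk L) ⟨1, hone⟩ = ⟨FreeGroup.mk L, hs L hL⟩ := by
    intro L
    induction L with
    | nil => intro hL; rfl
    | cons p L ih =>
      intro hL
      have hL' : L <:+ w.toWord := (List.suffix_cons p L).trans hL
      have hmul : (FreeGroup.mk (p :: L) : FreeGroup α) = FreeGroup.mk [p] * FreeGroup.mk L := by
        rw [FreeGroup.mul_mk]; rfl
      have hmem := hs _ hL
      simp only [hmul] at hmem ⊢
      rw [map_mul, Equiv.Perm.mul_apply, ih hL']
      obtain ⟨a, b⟩ := p
      cases b with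
      | true =>
        have : (FreeGroup.lift σ (FreeGroup.mk [(a, true)])) = σ a := FreeGroup.lift_apply_of ..
        rw [this]
        exact hσ a ⟨FreeGroup.mk L, hs L hL'⟩ hmem
      | false =>
        have hinv : (FreeGroup.mk [(a, false)] : FreeGroup α) = (FreeGroup.of a)⁻¹ := rfl
        simp only [hinv] at hmem ⊢
        rw [map_inv, FreeGroup.lift_apply_of, Equiv.Perm.inv_eq_iff_eq]
        rw [hσ a ⟨_, hmem⟩ (by simpa using hs L hL')]
        simp
  have h1 := key w.toWord List.suffix_rfl
  have h2 : (FreeGroup.lift σ (FreeGroup.mk w.toWord) ⟨1, hone⟩).1 = FreeGroup.mk w.toWord :=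
    congrArg Subtype.val h1
  rw [FreeGroup.mk_toWord, h] at h2
  exact h2.symm

/-- Finitely generated free groups are **Hopfian**: a surjective endomorphism permutes, by
precomposition, the finitely many homomorphisms to a given finite group. -/
theorem freeGroup_injective_of_surjective [Finite α] (φ : FreeGroup α →* FreeGroup α)
    (hφ : Function.Surjective φ) : Function.Injective φ := by
  rw [injective_iff_map_eq_one]
  intro w hw
  by_contra hne
  obtain ⟨s, ρ, hρ⟩ := exists_perm_hom_ne_one w hne
  have : Finite (FreeGroup α →* Equiv.Perm s) := Finite.of_equiv _ FreeGroup.lift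
  have hinj : Function.Injective fun ψ : FreeGroup α →* Equiv.Perm s => ψ.comp φ :=
    fun ψ ψ' h => (MonoidHom.cancel_right hφ).1 h
  obtain ⟨ψ, hψ⟩ := Finite.surjective_of_injective hinj ρ
  apply hρ
  rw [← hψ]
  simp [hw]

end Hopf

/-! ### Cayley graphs of free groups -/

section FreeCayley

variable {n : ℕ}

/-- The edge of the Cayley graph of a free group leading from a vertex other than `1` towards `1`:
it cancels the last letter of the reduced word. -/
def lastEdge (g : FreeGroup (Fin n)) : Option (FreeGroup (Fin n) × Fin n) :=
  g.toWord.getLast?.map fun p => if p.2 then (g * (FreeGroup.of p.1)⁻¹, p.1) else (g, p.1)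

/-- In the Cayley tree of a free group, each edge leads from one of its endpoints towards `1`. -/
theorem lastEdge_eq (g : FreeGroup (Fin n)) (j : Fin n) :
    lastEdge g = some (g, j) ∨ lastEdge (g * FreeGroup.of j) = some (g, j) := by
  by_cases h : g.toWord.getLast? = some (j, false)
  · left
    simp [lastEdge, h]
  · right
    have hred : FreeGroup.IsReduced (g.toWord ++ [(j, true)]) := by
      refine List.isChain_append.2 ⟨FreeGroup.isReduced_toWord, FreeGroup.IsReduced.singleton, ?_⟩
      rintro ⟨i, b⟩ ha c hc
      obtain rfl : (j, true) = c := by simpa using hc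
      rintro rfl
      cases b
      · exact absurd ha h
      · rfl
    have hw : (g * FreeGroup.of j).toWord = g.toWord ++ [(j, true)] := by
      rw [FreeGroup.toWord_mul, FreeGroup.toWord_of, hred.reduce_eq]
    simp [lastEdge, hw]

theorem card_inducedEdges_le_of_free (F : Finset (FreeGroup (Fin n))) :
    (inducedEdges (fun j : Fin n => FreeGroup.of j) F).card ≤ F.card := by
  classical
  calc _ = ((inducedEdges (fun j : Fin n => FreeGroup.of j) F).image some).card :=
        (Finset.card_image_of_injective _ (Option.some_injective _)).symm
    _ ≤ (F.image lastEdge).card := by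
        refine Finset.card_le_card fun e he => ?_
        obtain ⟨⟨g, j⟩, hgj, rfl⟩ := Finset.mem_image.1 he
        obtain ⟨h1, h2⟩ := mem_inducedEdges.1 hgj
        rcases lastEdge_eq g j with h | h
        · exact Finset.mem_image.2 ⟨g, h1, h⟩
        · exact Finset.mem_image.2 ⟨_, h2, h⟩
    _ ≤ _ := Finset.card_image_le

end FreeCayley

/-! ### Connected subgraphs -/

section Linked

variable {n : ℕ} {G : Type u} [Group G] {x : Fin n → G}

/-- Two vertices of the Cayley graph are linked by a set `E` of edges if a path along edges in
`E`, traversed in either direction, joins them. -/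
def Linked (x : Fin n → G) (E : Set (G × Fin n)) : G → G → Prop :=
  Relation.EqvGen fun a b => ∃ j, (a, j) ∈ E ∧ a * x j = b

namespace Linked

variable {E E' : Set (G × Fin n)} {a b c : G}

theorem refl (a : G) : Linked x E a a := Relation.EqvGen.refl a

theorem symm (h : Linked x E a b) : Linked x E b a := Relation.EqvGen.symm _ _ h

theorem trans (h : Linked x E a b) (h' : Linked x E b c) : Linked x E a c :=
  Relation.EqvGen.trans _ _ _ h h'

theorem of_mem {j : Fin n} (h : (a, j) ∈ E) : Linked x E a (a * x j) :=
  Relation.EqvGen.rel _ _ ⟨j, h, rfl⟩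

/-- Linking by `E` implies linking by `E'` if the endpoints of each edge in `E` are linked
by `E'`. -/
theorem of_forall (hE : ∀ g j, (g, j) ∈ E → Linked x E' g (g * x j)) (h : Linked x E a b) :
    Linked x E' a b := by
  induction h with
  | rel a b h => obtain ⟨j, hj, rfl⟩ := h; exact hE a j hj
  | refl a => exact refl a
  | symm a b _ ih => exact ih.symm
  | trans a b c _ _ ih ih' => exact ih.trans ih'

theorem mono (hE : E ⊆ E') (h : Linked x E a b) : Linked x E' a b :=
  h.of_forall fun _ _ hg => of_mem (hE hg)

/-- Left translation is an automorphism of the Cayley graph. -/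
theorem translate (g : G) (h : Linked x E a b) :
    Linked x {e | (g⁻¹ * e.1, e.2) ∈ E} (g * a) (g * b) := by
  induction h with
  | rel a b h =>
    obtain ⟨j, hj, rfl⟩ := h
    rw [← mul_assoc]
    exact of_mem (by simpa using hj)
  | refl a => exact refl _
  | symm a b _ ih => exact ih.symm
  | trans a b c _ _ ih ih' => exact ih.trans ih'

end Linked

namespace CayleySubgraph

theorem mem_verts_iff_of_linked (H : CayleySubgraph x) {a b : G} (h : Linked x H.edges a b) :
    a ∈ H.verts ↔ b ∈ H.verts := by
  induction h with
  | rel a b h =>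
    obtain ⟨j, hj, rfl⟩ := h
    exact ⟨fun _ => H.target_mem _ hj, fun _ => H.source_mem _ hj⟩
  | refl a => exact Iff.rfl
  | symm a b _ ih => exact ih.symm
  | trans a b c _ _ ih ih' => exact ih.trans ih'

theorem nonempty_path_of_linked (H : CayleySubgraph x) {a b : G} (h : Linked x H.edges a b)
    (ha : a ∈ H.verts) (hb : b ∈ H.verts) :
    Nonempty (@Quiver.Path (Quiver.Symmetrify H.Vertex) _ (⟨a, ha⟩ : H.Vertex) ⟨b, hb⟩) := by
  induction h with
  | rel a b h =>
    obtain ⟨j, hj, hab⟩ := h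
    let e : (⟨a, ha⟩ : H.Vertex) ⟶ ⟨b, hb⟩ := ⟨(a, j), hj, rfl, hab⟩
    exact ⟨e.toPosPath⟩
  | refl a => exact ⟨Quiver.Path.nil⟩
  | symm a b _ ih => exact (ih hb ha).map Quiver.Path.reverse
  | trans a b c hab hbc ih ih' =>
    have hb' := (H.mem_verts_iff_of_linked hab).1 ha
    obtain ⟨p⟩ := ih ha hb'
    obtain ⟨q⟩ := ih' hb' hb
    exact ⟨p.comp q⟩

theorem isConnected_of_linked (H : CayleySubgraph x) (a : G) (ha : a ∈ H.verts)
    (h : ∀ b ∈ H.verts, Linked x H.edges a b) : H.IsConnected :=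
  ⟨⟨⟨a, ha⟩⟩, fun v w => H.nonempty_path_of_linked ((h _ v.mem).symm.trans (h _ w.mem)) v.mem w.mem⟩

theorem beta0_pos (H : CayleySubgraph x) (hf : H.IsFinite) (hc : H.IsConnected) : 0 < H.beta0 := by
  obtain ⟨⟨v⟩, -⟩ := hc
  exact (Set.ncard_pos hf.1).2 ⟨v.val, v.mem⟩

theorem ncard_edges_le (H : CayleySubgraph x) (hf : H.IsFinite) :
    H.edges.ncard ≤ (inducedEdges x hf.1.toFinset).card := by
  rw [← Set.ncard_coe_finset]
  refine Set.ncard_le_ncard (fun e he => ?_) (Finset.finite_toSet _)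
  simpa [mem_inducedEdges] using ⟨H.source_mem e he, H.target_mem e he⟩

/-- Euler's formula for the cyclomatic quotient. -/
theorem xi_eq (H : CayleySubgraph x) (hf : H.IsFinite) (hc : H.IsConnected) :
    H.xi = (H.edges.ncard : ℝ) / H.beta0 - 1 + 1 / H.beta0 := by
  have h0 : (0 : ℝ) < H.beta0 := by exact_mod_cast H.beta0_pos hf hc
  have h1 : (H.beta2 : ℝ) + H.beta0 = H.edges.ncard + 1 := by
    exact_mod_cast H.beta2_add_beta0 hf hc
  rw [xi]
  field_simp
  linarith

theorem beta0_eq (H : CayleySubgraph x) (hf : H.IsFinite) : H.beta0 = hf.1.toFinset.card := by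
  rw [beta0, Set.ncard_eq_toFinset_card _ hf.1]

/-- An isoperimetric inequality for sets of vertices bounds the cyclomatic quotient. -/
theorem xi_le_of_forall (H : CayleySubgraph x) (hf : H.IsFinite) (hc : H.IsConnected) (c : ℝ)
    (h : ∀ F : Finset G, ((inducedEdges x F).card : ℝ) ≤ c * F.card) :
    H.xi ≤ c - 1 + 1 / H.beta0 := by
  have h0 : (0 : ℝ) < H.beta0 := by exact_mod_cast H.beta0_pos hf hc
  rw [H.xi_eq hf hc]
  gcongr
  rw [div_le_iff₀ h0, H.beta0_eq hf]
  refine le_trans ?_ (h _)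
  exact_mod_cast H.ncard_edges_le hf

theorem xi_le (H : CayleySubgraph x) (hf : H.IsFinite) (hc : H.IsConnected) :
    H.xi ≤ n - 1 + 1 / H.beta0 :=
  H.xi_le_of_forall hf hc n fun F => by exact_mod_cast card_inducedEdges_le x F

theorem xi_nonneg (H : CayleySubgraph x) : 0 ≤ H.xi := by
  rw [xi]; positivity

end CayleySubgraph

/-- The full subgraph on a finite set of vertices. -/
def inducedSubgraph (x : Fin n → G) (F : Finset G) : CayleySubgraph x where
  verts := F
  edges := inducedEdges x F
  source_mem _ h := (mem_inducedEdges.1 h).1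
  target_mem _ h := (mem_inducedEdges.1 h).2

theorem inducedSubgraph_isFinite (x : Fin n → G) (F : Finset G) :
    (inducedSubgraph x F).IsFinite :=
  ⟨F.finite_toSet, Finset.finite_toSet _⟩

theorem inducedEdges_mono {F F' : Finset G} (h : F ⊆ F') : inducedEdges x F ⊆ inducedEdges x F' :=
  fun _ he => mem_inducedEdges.2 ⟨h (mem_inducedEdges.1 he).1, h (mem_inducedEdges.1 he).2⟩

/-- A finite set of vertices is rooted if it contains `1` and the full subgraph on it is
connected. -/
def IsRooted (x : Fin n → G) (F : Finset G) : Prop :=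
  1 ∈ F ∧ ∀ a ∈ F, Linked x (inducedEdges x F : Set (G × Fin n)) 1 a

theorem IsRooted.isConnected {F : Finset G} (h : IsRooted x F) :
    (inducedSubgraph x F).IsConnected :=
  (inducedSubgraph x F).isConnected_of_linked 1 h.1 h.2

theorem isRooted_singleton : IsRooted x {1} := by
  refine ⟨Finset.mem_singleton_self 1, fun a ha => ?_⟩
  rw [Finset.mem_singleton.1 ha]
  exact Linked.refl 1

theorem IsRooted.union [DecidableEq G] {F F' : Finset G} (h : IsRooted x F) (h' : IsRooted x F') :
    IsRooted x (F ∪ F') := by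
  refine ⟨Finset.mem_union_left _ h.1, fun a ha => ?_⟩
  rcases Finset.mem_union.1 ha with ha | ha
  · exact (h.2 a ha).mono (inducedEdges_mono Finset.subset_union_left)
  · exact (h'.2 a ha).mono (inducedEdges_mono Finset.subset_union_right)

theorem xi_inducedSubgraph {F : Finset G} (h : IsRooted x F) :
    (inducedSubgraph x F).xi = ((inducedEdges x F).card : ℝ) / F.card - 1 + 1 / F.card := by
  rw [CayleySubgraph.xi_eq _ (inducedSubgraph_isFinite x F) h.isConnected]
  simp only [CayleySubgraph.beta0, inducedSubgraph, Set.ncard_coe_finset]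

end Linked

/-! ### Balls -/

section Balls

open scoped Pointwise

variable {n : ℕ} {G : Type u} [Group G] [DecidableEq G] {x : Fin n → G}

/-- The ball of radius one in the Cayley graph; its powers are the balls of larger radius. -/
def unitBall (x : Fin n → G) : Finset G :=
  insert 1 (Finset.univ.image x ∪ Finset.univ.image fun j => (x j)⁻¹)

theorem mem_unitBall {g : G} : g ∈ unitBall x ↔ g = 1 ∨ (∃ j, x j = g) ∨ ∃ j, (x j)⁻¹ = g := by
  simp [unitBall]

theorem one_mem_unitBall : (1 : G) ∈ unitBall x := Finset.mem_insert_self _ _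

theorem unitBall_inv : (unitBall x)⁻¹ = unitBall x := by
  ext g
  simp only [Finset.mem_inv', mem_unitBall, inv_eq_one, inv_inj]
  refine or_congr_right ?_
  rw [or_comm]
  exact or_congr_right (exists_congr fun j => inv_eq_iff_eq_inv.symm)

theorem unitBall_pow_mono {i j : ℕ} (h : i ≤ j) : unitBall x ^ i ⊆ unitBall x ^ j :=
  Finset.pow_subset_pow_right one_mem_unitBall h

theorem exists_mem_unitBall_pow (hx : Subgroup.closure (Set.range x) = ⊤) (g : G) :
    ∃ i, g ∈ unitBall x ^ i := by
  have hg : g ∈ Subgroup.closure (Set.range x) := by rw [hx]; trivial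
  induction hg using Subgroup.closure_induction with
  | mem g hg =>
    obtain ⟨j, rfl⟩ := hg
    exact ⟨1, by rw [pow_one]; exact mem_unitBall.2 (Or.inr (Or.inl ⟨j, rfl⟩))⟩
  | one => exact ⟨0, by simp⟩
  | mul a b _ _ ha hb =>
    obtain ⟨i, hi⟩ := ha
    obtain ⟨k, hk⟩ := hb
    exact ⟨i + k, by rw [pow_add]; exact Finset.mul_mem_mul hi hk⟩
  | inv a _ ha =>
    obtain ⟨i, hi⟩ := ha
    refine ⟨i, ?_⟩
    rw [← unitBall_inv, inv_pow, Finset.mem_inv', inv_inv]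
    exact hi

theorem exists_subset_unitBall_pow (hx : Subgroup.closure (Set.range x) = ⊤) (F : Finset G) :
    ∃ i, F ⊆ unitBall x ^ i := by
  choose i hi using exists_mem_unitBall_pow hx
  exact ⟨F.sup i, fun g hg => unitBall_pow_mono (Finset.le_sup hg) (hi g)⟩

theorem IsRooted.mul_unitBall {F : Finset G} (h : IsRooted x F) : IsRooted x (F * unitBall x) := by
  have hsub : F ⊆ F * unitBall x := Finset.subset_mul_left _ one_mem_unitBall
  refine ⟨hsub h.1, fun a ha => ?_⟩
  obtain ⟨b, hb, s, hs, rfl⟩ := Finset.mem_mul.1 ha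
  refine ((h.2 b hb).mono (inducedEdges_mono hsub)).trans ?_
  rcases mem_unitBall.1 hs with rfl | ⟨j, rfl⟩ | ⟨j, rfl⟩
  · rw [mul_one]; exact Linked.refl b
  · exact Linked.of_mem (mem_inducedEdges.2 ⟨hsub hb, ha⟩)
  · have : Linked x (inducedEdges x (F * unitBall x) : Set (G × Fin n))
        (b * (x j)⁻¹) (b * (x j)⁻¹ * x j) :=
      Linked.of_mem (mem_inducedEdges.2 ⟨ha, by simpa using hsub hb⟩)
    rw [inv_mul_cancel_right] at this
    exact this.symm

theorem isRooted_unitBall_pow (i : ℕ) : IsRooted x (unitBall x ^ i) := by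
  induction i with
  | zero => exact isRooted_singleton
  | succ i ih => rw [pow_succ]; exact ih.mul_unitBall

/-- An increasing sequence of rooted sets containing the balls gives an exhausting chain. -/
theorem isExhaustingChain_of_isRooted (hx : Subgroup.closure (Set.range x) = ⊤)
    (W : ℕ → Finset G) (hr : ∀ i, IsRooted x (W i)) (hs : ∀ i, W i ⊆ W (i + 1))
    (hb : ∀ i, unitBall x ^ i ⊆ W i) : IsExhaustingChain fun i => inducedSubgraph x (W i) where
  finite i := inducedSubgraph_isFinite x _
  connected i := (hr i).isConnected
  le_succ i := ⟨hs i, inducedEdges_mono (hs i)⟩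
  verts_exhaust g := (exists_mem_unitBall_pow hx g).imp fun i hi => hb i hi
  edges_exhaust e := by
    obtain ⟨i, hi⟩ := exists_subset_unitBall_pow hx {e.1, e.1 * x e.2}
    exact ⟨i, mem_inducedEdges.2 ⟨hb i (hi (by simp)), hb i (hi (by simp))⟩⟩

theorem isExhaustingChain_balls (hx : Subgroup.closure (Set.range x) = ⊤) :
    IsExhaustingChain fun i => inducedSubgraph x (unitBall x ^ i) :=
  isExhaustingChain_of_isRooted hx _ isRooted_unitBall_pow
    (fun i => unitBall_pow_mono i.le_succ) fun _ => subset_rfl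

end Balls

/-! ### Exhausting chains of Følner sets -/

section FolnerChain

open scoped Pointwise

variable {n : ℕ} {G : Type u} [Group G] {x : Fin n → G}

/-- In an infinite group every nonempty finite set of vertices has an edge leaving it. -/
theorem card_inducedEdges_lt [Infinite G] (hx : Subgroup.closure (Set.range x) = ⊤) (F : Finset G)
    (hF : F.Nonempty) : (inducedEdges x F).card < n * F.card := by
  classical
  refine lt_of_le_of_ne (card_inducedEdges_le x F) fun heq => ?_
  have h0 := card_inducedEdges_add x F
  have h1 : ((F ×ˢ Finset.univ).filter fun e : G × Fin n => e.1 * x e.2 ∉ F).card = 0 := by omega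
  have h2 : ∀ a ∈ F, ∀ j, a * x j ∈ F := by
    intro a ha j
    have := Finset.filter_eq_empty_iff.1 (Finset.card_eq_zero.1 h1) (x := (a, j))
      (by simpa using ha)
    simpa using this
  have h3 : ∀ g a : G, a ∈ F ↔ a * g ∈ F := by
    intro g
    have hg : g ∈ Subgroup.closure (Set.range x) := by rw [hx]; trivial
    induction hg using Subgroup.closure_induction with
    | mem g hg =>
      obtain ⟨j, rfl⟩ := hg
      refine fun a => ⟨fun ha => h2 a ha j, fun ha => ?_⟩
      have himg : F.image (fun b => b * x j) = F :=
        Finset.eq_of_subset_of_card_le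
          (fun b hb => by obtain ⟨c, hc, rfl⟩ := Finset.mem_image.1 hb; exact h2 c hc j)
          (Finset.card_image_of_injective _ (mul_left_injective (x j))).ge
      rw [← himg] at ha
      obtain ⟨b, hb, hba⟩ := Finset.mem_image.1 ha
      rwa [← mul_left_injective (x j) hba]
    | one => simp
    | mul g h _ _ hg hh => exact fun a => by rw [hg a, hh, mul_assoc]
    | inv g _ hg => exact fun a => by rw [hg (a * g⁻¹), inv_mul_cancel_right]
  obtain ⟨a, ha⟩ := hF
  obtain ⟨g, hg⟩ := Infinite.exists_notMem_finset F
  apply hg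
  have := (h3 (a⁻¹ * g) a).1 ha
  rwa [mul_inv_cancel_left] at this

/-- A Følner set with the fewest elements is connected; it can be translated to contain `1`. -/
theorem exists_isRooted_folner (ε : ℝ)
    (h : ∃ F : Finset G, F.Nonempty ∧ (n - ε) * F.card ≤ (inducedEdges x F).card) :
    ∃ F : Finset G, IsRooted x F ∧ (n - ε) * F.card ≤ (inducedEdges x F).card := by
  classical
  obtain ⟨F₀, ⟨hne₀, hcard₀⟩, hmin₀⟩ := WellFounded.has_min (measure (Finset.card (α := G))).wf
    {F : Finset G | F.Nonempty ∧ (n - ε) * F.card ≤ (inducedEdges x F).card} h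
  obtain ⟨a, ha⟩ := hne₀
  set F := F₀.image fun g => a⁻¹ * g with hF
  have hcF : F.card = F₀.card := Finset.card_image_of_injective _ (mul_right_injective _)
  have h1F : 1 ∈ F := Finset.mem_image.2 ⟨a, ha, by simp⟩
  have hmem : ∀ g, a⁻¹ * g ∈ F ↔ g ∈ F₀ := by
    intro g
    simp [hF]
  have hcE : (inducedEdges x F₀).card ≤ (inducedEdges x F).card := by
    refine Finset.card_le_card_of_injOn (fun e => (a⁻¹ * e.1, e.2)) ?_ ?_
    · intro e he
      have := mem_inducedEdges.1 he
      refine mem_inducedEdges.2 ⟨(hmem _).2 this.1, ?_⟩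
      rw [mul_assoc]
      exact (hmem _).2 this.2
    · rintro ⟨g, j⟩ - ⟨g', j'⟩ - h
      simpa using h
  have hcF' : (n - ε) * F.card ≤ (inducedEdges x F).card := by
    rw [hcF]
    exact hcard₀.trans (by exact_mod_cast hcE)
  refine ⟨F, ⟨h1F, ?_⟩, hcF'⟩
  have hmin : ∀ A : Finset G, A.Nonempty → A.card < F.card →
      ((inducedEdges x A).card : ℝ) < (n - ε) * A.card := by
    intro A hA hlt
    by_contra! hle
    exact hmin₀ A ⟨hA, hle⟩ (hlt.trans_eq hcF)
  by_contra! hcon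
  obtain ⟨b, hbF, hb⟩ := hcon
  -- otherwise `F` splits into two parts without edges between them, one of which is as good
  set A := F.filter fun c => Linked x (inducedEdges x F : Set (G × Fin n)) 1 c
  set B := F.filter fun c => ¬ Linked x (inducedEdges x F : Set (G × Fin n)) 1 c
  have hAB : A.card + B.card = F.card := Finset.card_filter_add_card_filter_not _
  have hA : A.Nonempty := ⟨1, Finset.mem_filter.2 ⟨h1F, Linked.refl 1⟩⟩
  have hB : B.Nonempty := ⟨b, Finset.mem_filter.2 ⟨hbF, hb⟩⟩
  have hA' := hmin A hA (by have := hB.card_pos; omega)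
  have hB' := hmin B hB (by have := hA.card_pos; omega)
  have hsub : inducedEdges x F ⊆ inducedEdges x A ∪ inducedEdges x B := by
    intro e he
    have hlink : Linked x (inducedEdges x F : Set (G × Fin n)) e.1 (e.1 * x e.2) :=
      Linked.of_mem he
    obtain ⟨h1, h2⟩ := mem_inducedEdges.1 he
    by_cases h3 : Linked x (inducedEdges x F : Set (G × Fin n)) 1 e.1
    · exact Finset.mem_union_left _ (mem_inducedEdges.2
        ⟨Finset.mem_filter.2 ⟨h1, h3⟩, Finset.mem_filter.2 ⟨h2, h3.trans hlink⟩⟩)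
    · exact Finset.mem_union_right _ (mem_inducedEdges.2
        ⟨Finset.mem_filter.2 ⟨h1, h3⟩, Finset.mem_filter.2 ⟨h2, fun h4 =>
          h3 (h4.trans hlink.symm)⟩⟩)
  have hle : ((inducedEdges x F).card : ℝ) ≤ (inducedEdges x A).card + (inducedEdges x B).card := by
    exact_mod_cast (Finset.card_le_card hsub).trans (Finset.card_union_le _ _)
  have hAB' : (A.card : ℝ) + B.card = F.card := by exact_mod_cast hAB
  rw [← hAB'] at hcF'
  linarith

/-- A rooted set can be enlarged to a rooted Følner set, as Følner sets of an infinite group can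
be arbitrarily large. -/
theorem exists_isRooted_folner_superset [DecidableEq G] [Infinite G]
    (hx : Subgroup.closure (Set.range x) = ⊤)
    (h : ∀ ε : ℝ, 0 < ε → ∃ F : Finset G, F.Nonempty ∧
      (n - ε) * F.card ≤ (inducedEdges x F).card)
    (W : Finset G) (hW : IsRooted x W) (ε : ℝ) (hε : 0 < ε) :
    ∃ W' : Finset G, IsRooted x W' ∧ W ⊆ W' ∧ (n - ε) * W'.card ≤ (inducedEdges x W').card := by
  -- a Følner set `F` for `δ` has at least `1 / δ` elements, since some edge leaves it; this makes
  -- up for the vertices of `W` without edges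
  set δ : ℝ := ε / (2 * (n * W.card + 1)) with hδ
  have hK : (0 : ℝ) < n * W.card + 1 := by positivity
  have hδ0 : 0 < δ := by positivity
  have hδε : δ ≤ ε / 2 := by
    rw [hδ]
    apply div_le_div_of_nonneg_left hε.le (by norm_num)
    have : (0 : ℝ) ≤ n * W.card := by positivity
    linarith
  obtain ⟨F, hF, hcard⟩ := exists_isRooted_folner δ (h δ hδ0)
  have hlt : ((inducedEdges x F).card : ℝ) + 1 ≤ n * F.card := by
    exact_mod_cast card_inducedEdges_lt hx F ⟨1, hF.1⟩
  have hbig : (n : ℝ) * W.card + 1 ≤ ε / 2 * F.card := by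
    have h1 : 1 ≤ δ * F.card := by linarith
    calc (n : ℝ) * W.card + 1 ≤ (n * W.card + 1) * (δ * F.card) := le_mul_of_one_le_right hK.le h1
      _ = ε / 2 * F.card := by rw [hδ]; field_simp
  refine ⟨W ∪ F, hW.union hF, Finset.subset_union_left, ?_⟩
  have hE : ((inducedEdges x F).card : ℝ) ≤ (inducedEdges x (W ∪ F)).card := by
    exact_mod_cast Finset.card_le_card (inducedEdges_mono Finset.subset_union_right)
  have hV : ((W ∪ F).card : ℝ) ≤ W.card + F.card := by exact_mod_cast Finset.card_union_le _ _
  rcases le_total 0 ((n : ℝ) - ε) with hn | hn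
  · calc (n - ε) * ((W ∪ F).card : ℝ) ≤ (n - ε) * (W.card + F.card) := by gcongr
      _ ≤ (n - δ) * F.card := by
        have h1 : δ * F.card ≤ ε / 2 * F.card := by gcongr
        have h2 : 0 ≤ ε * W.card := by positivity
        linarith
      _ ≤ _ := hcard.trans hE
  · have : (0 : ℝ) ≤ (inducedEdges x (W ∪ F)).card := by positivity
    exact (mul_nonpos_of_nonpos_of_nonneg hn (by positivity)).trans this

/-- An infinite group satisfying Følner's condition has an exhausting chain of full subgraphs on
Følner sets. -/
theorem exists_folner_chain [DecidableEq G] [Infinite G]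
    (hx : Subgroup.closure (Set.range x) = ⊤)
    (h : ∀ ε : ℝ, 0 < ε → ∃ F : Finset G, F.Nonempty ∧
      (n - ε) * F.card ≤ (inducedEdges x F).card) :
    ∃ W : ℕ → Finset G, (∀ i, IsRooted x (W i)) ∧
      (IsExhaustingChain fun i => inducedSubgraph x (W i)) ∧
      ∀ i : ℕ, (n - 1 / ((i : ℝ) + 1)) * (W (i + 1)).card ≤ (inducedEdges x (W (i + 1))).card := by
  choose! next hroot hsub hcard using
    fun (ε : ℝ) (W : Finset G) (hW : IsRooted x W) (hε : 0 < ε) =>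
      exists_isRooted_folner_superset hx h (W * unitBall x) hW.mul_unitBall ε hε
  let W : ℕ → Finset G := fun i => Nat.rec {1} (fun i W => next (1 / ((i : ℝ) + 1)) W) i
  have hr : ∀ i, IsRooted x (W i) := by
    intro i
    induction i with
    | zero => exact isRooted_singleton
    | succ i ih => exact hroot _ _ ih Nat.one_div_pos_of_nat
  have hs : ∀ i, W i * unitBall x ⊆ W (i + 1) := fun i => hsub _ _ (hr i) Nat.one_div_pos_of_nat
  refine ⟨W, hr, isExhaustingChain_of_isRooted hx W hr
    (fun i => (Finset.subset_mul_left _ one_mem_unitBall).trans (hs i)) ?_,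
    fun i => hcard _ _ (hr i) Nat.one_div_pos_of_nat⟩
  intro i
  induction i with
  | zero => exact subset_rfl
  | succ i ih =>
    rw [pow_succ]
    exact (Finset.mul_subset_mul_right ih).trans (hs i)

end FolnerChain

/-! ### Circuits in Cayley graphs of groups with a nontrivial relation -/

section Circuit

variable {n : ℕ} {G : Type u} [Group G] (x : Fin n → G)

/-- The value in `G` of a word in the generators. -/
def wordVal (L : List (Fin n × Bool)) : G := FreeGroup.lift x (FreeGroup.mk L)

theorem wordVal_nil : wordVal x [] = 1 := map_one (FreeGroup.lift x)

theorem wordVal_append (L L' : List (Fin n × Bool)) :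
    wordVal x (L ++ L') = wordVal x L * wordVal x L' := by
  rw [wordVal, ← FreeGroup.mul_mk, map_mul]; rfl

theorem wordVal_cons (p : Fin n × Bool) (L : List (Fin n × Bool)) :
    wordVal x (p :: L) = wordVal x [p] * wordVal x L := wordVal_append x [p] L

theorem wordVal_true (j : Fin n) : wordVal x [(j, true)] = x j := FreeGroup.lift_apply_of ..

theorem wordVal_false (j : Fin n) : wordVal x [(j, false)] = (x j)⁻¹ := by
  have : (FreeGroup.mk [(j, false)] : FreeGroup (Fin n)) = (FreeGroup.of j)⁻¹ := rfl
  rw [wordVal, this, map_inv, FreeGroup.lift_apply_of]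

/-- The edge of the Cayley graph traversed by a letter read from the vertex `g`. -/
def letterEdge (g : G) (p : Fin n × Bool) : G × Fin n :=
  if p.2 then (g, p.1) else (g * (x p.1)⁻¹, p.1)

/-- The edges of the Cayley graph traversed by a word read from the vertex `g`. -/
def wordEdges : G → List (Fin n × Bool) → Set (G × Fin n)
  | _, [] => ∅
  | g, p :: L => insert (letterEdge x g p) (wordEdges (g * wordVal x [p]) L)

theorem wordEdges_finite (g : G) (L : List (Fin n × Bool)) : (wordEdges x g L).Finite := by
  induction L generalizing g with
  | nil => exact Set.finite_empty
  | cons p L ih => exact (ih _).insert _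

theorem linked_letterEdge (g : G) (p : Fin n × Bool) (E : Set (G × Fin n))
    (h : letterEdge x g p ∈ E) : Linked x E g (g * wordVal x [p]) := by
  obtain ⟨j, b⟩ := p
  cases b with
  | true =>
    rw [wordVal_true]
    exact Linked.of_mem h
  | false =>
    rw [wordVal_false]
    have : Linked x E (g * (x j)⁻¹) (g * (x j)⁻¹ * x j) := Linked.of_mem h
    rw [inv_mul_cancel_right] at this
    exact this.symm

theorem linked_wordEdges (g : G) (L : List (Fin n × Bool)) :
    Linked x (wordEdges x g L) g (g * wordVal x L) := by
  induction L generalizing g with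
  | nil => rw [wordVal_nil, mul_one]; exact Linked.refl g
  | cons p L ih =>
    rw [wordVal_cons, ← mul_assoc]
    exact (linked_letterEdge x g p _ (Set.mem_insert _ _)).trans
      ((ih _).mono (Set.subset_insert _ _))

theorem exists_eq_append_of_mem_wordEdges {g : G} {L : List (Fin n × Bool)} {e : G × Fin n}
    (he : e ∈ wordEdges x g L) :
    ∃ P p S, L = P ++ p :: S ∧ letterEdge x (g * wordVal x P) p = e := by
  induction L generalizing g with
  | nil => exact absurd he (Set.notMem_empty e)
  | cons q L ih =>
    rcases he with rfl | he
    · exact ⟨[], q, L, rfl, by rw [wordVal_nil, mul_one]⟩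
    · obtain ⟨P, p, S, rfl, hp⟩ := ih he
      exact ⟨q :: P, p, S, rfl, by rw [wordVal_cons, ← mul_assoc, hp]⟩

/-- If the generators satisfy a nontrivial relation, then some edge of the Cayley graph is bypassed
by a path: a shortest relation traverses its first edge only once. -/
theorem exists_bypassed_edge (hx : ¬ Function.Injective (FreeGroup.lift x)) :
    ∃ (e : G × Fin n) (P : Set (G × Fin n)), P.Finite ∧ e ∉ P ∧
      Linked x P e.1 (e.1 * x e.2) := by
  obtain ⟨w, hw, hw1⟩ : ∃ w, FreeGroup.lift x w = 1 ∧ w ≠ 1 := by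
    rw [injective_iff_map_eq_one] at hx
    push Not at hx
    exact hx
  obtain ⟨L, ⟨hred, hval, hne⟩, hmin⟩ :=
    WellFounded.has_min (measure (List.length (α := Fin n × Bool))).wf
      {L | FreeGroup.IsReduced L ∧ wordVal x L = 1 ∧ L ≠ []}
      ⟨w.toWord, FreeGroup.isReduced_toWord, by rw [wordVal, FreeGroup.mk_toWord, hw],
        by simpa using hw1⟩
  have hmin' : ∀ L', FreeGroup.IsReduced L' → wordVal x L' = 1 → L'.length < L.length →
      L' = [] := by
    intro L' h1 h2 h3
    by_contra h4
    exact hmin L' ⟨h1, h2, h4⟩ h3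
  obtain ⟨p, U, rfl⟩ := List.exists_cons_of_ne_nil hne
  have hlink : Linked x (wordEdges x (wordVal x [p]) U) 1 (wordVal x [p]) := by
    have := linked_wordEdges x (wordVal x [p]) U
    rw [← wordVal_cons, hval] at this
    exact this.symm
  refine ⟨letterEdge x 1 p, wordEdges x (wordVal x [p]) U, wordEdges_finite _ _ _, ?_, ?_⟩
  · intro hmem
    obtain ⟨P, q, S, rfl, hq⟩ := exists_eq_append_of_mem_wordEdges x hmem
    -- the first edge is not traversed again in the same direction
    have hsame : wordVal x [p] * wordVal x P ≠ 1 := by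
      intro h
      rw [← wordVal_cons] at h
      have hpre : p :: P <+: p :: (P ++ q :: S) := by simp
      have := hmin' (p :: P) (hred.infix hpre.isInfix) h (by simp)
      simp at this
    -- nor in the opposite direction, unless the second letter cancels the first
    have hopp : p.1 = q.1 → wordVal x P = 1 → p.2 = q.2 := by
      intro h h'
      have hinf : P <:+: p :: (P ++ q :: S) := ⟨[p], q :: S, by simp⟩
      have hP := hmin' P (hred.infix hinf) h' (by simp)
      subst hP
      have := (List.isChain_cons_cons.1 hred).1
      exact this h
    obtain ⟨i, b⟩ := p
    obtain ⟨j, c⟩ := q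
    have hij : i = j := by
      have h := congrArg Prod.snd hq
      cases b <;> cases c <;> simpa [letterEdge, eq_comm] using h
    subst hij
    have h1 := congrArg Prod.fst hq
    cases b <;> cases c <;>
      simp only [letterEdge, wordVal_true, wordVal_false, if_true, if_false, one_mul,
        Bool.false_eq_true] at h1 hsame hopp
    · exact hsame (by simpa using h1)
    · exact absurd (hopp trivial (by simpa using h1)) (by simp)
    · refine absurd (hopp trivial ?_) (by simp)
      have h2 := mul_inv_eq_one.1 h1
      simpa using h2
    · exact hsame h1
  · obtain ⟨j, b⟩ := p
    cases b with
    | true => simpa [letterEdge, wordVal_true] using hlink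
    | false => simpa [letterEdge, wordVal_false] using hlink.symm

open scoped Pointwise in
/-- In a finite set of group elements there is a subset of positive proportion which is discrete
in the sense that no quotient of two of its elements lies in a given finite set `T`. -/
theorem exists_separated_subset [DecidableEq G] (T B : Finset G) :
    ∃ D ⊆ B, (∀ d ∈ D, ∀ d' ∈ D, d ≠ d' → d⁻¹ * d' ∉ T) ∧
      B.card ≤ D.card * (insert 1 (T ∪ T⁻¹)).card := by
  set Q : Finset (Finset G) :=
    B.powerset.filter fun D => ∀ d ∈ D, ∀ d' ∈ D, d ≠ d' → d⁻¹ * d' ∉ T with hQ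
  obtain ⟨D, hD, hmax⟩ := Q.exists_max_image Finset.card ⟨∅, by simp [hQ]⟩
  obtain ⟨hDB, hsep⟩ := Finset.mem_filter.1 hD
  rw [Finset.mem_powerset] at hDB
  refine ⟨D, hDB, hsep, ?_⟩
  refine (Finset.card_le_card (t := D * insert 1 (T ∪ T⁻¹)) fun b hb => ?_).trans
    Finset.card_mul_le
  by_contra hcon
  have hfar : ∀ d ∈ D, d⁻¹ * b ≠ 1 ∧ d⁻¹ * b ∉ T ∧ b⁻¹ * d ∉ T := by
    intro d hd
    have : d⁻¹ * b ∉ insert 1 (T ∪ T⁻¹) := fun h =>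
      hcon (Finset.mem_mul.2 ⟨d, hd, _, h, mul_inv_cancel_left d b⟩)
    simpa [Finset.mem_inv', not_or] using this
  have hbD : b ∉ D := fun h => (hfar b h).1 (inv_mul_cancel b)
  have hins : insert b D ∈ Q := by
    refine Finset.mem_filter.2 ⟨Finset.mem_powerset.2 (Finset.insert_subset hb hDB), ?_⟩
    intro d hd d' hd' hne
    rcases Finset.mem_insert.1 hd with rfl | hd1 <;> rcases Finset.mem_insert.1 hd' with rfl | hd2
    · exact absurd rfl hne
    · exact (hfar d' hd2).2.2
    · exact (hfar d hd1).2.1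
    · exact hsep d hd1 d' hd2 hne
  have := hmax _ hins
  rw [Finset.card_insert_of_notMem hbD] at this
  omega

variable {x}

/-- Translates of a bypassed edge by sufficiently separated elements can be removed at the same
time from a connected full subgraph, so there are not more of them than independent cycles. -/
theorem card_add_card_le_of_separated {e : G × Fin n} {P : Set (G × Fin n)} (heP : e ∉ P)
    (hP : Linked x P e.1 (e.1 * x e.2)) {W : Finset G} (hW : IsRooted x W) (D : Finset G)
    (hDe : ∀ d ∈ D, (d * e.1, e.2) ∈ inducedEdges x W)
    (hDP : ∀ d ∈ D, ∀ p ∈ P, (d * p.1, p.2) ∈ inducedEdges x W)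
    (hsep : ∀ d ∈ D, ∀ d' ∈ D, d ≠ d' → (d⁻¹ * d' * e.1, e.2) ∉ P) :
    D.card + W.card ≤ (inducedEdges x W).card + 1 := by
  classical
  set R : Finset (G × Fin n) := D.image fun d => (d * e.1, e.2) with hR
  have hRc : R.card = D.card := by
    refine Finset.card_image_of_injective _ fun d d' h => ?_
    simpa using h
  have hRsub : R ⊆ inducedEdges x W := by
    intro f hf
    obtain ⟨d, hd, rfl⟩ := Finset.mem_image.1 hf
    exact hDe d hd
  let H : CayleySubgraph x :=
    { verts := W
      edges := (inducedEdges x W \ R : Finset (G × Fin n))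
      source_mem := fun f hf => (mem_inducedEdges.1 (Finset.mem_sdiff.1 hf).1).1
      target_mem := fun f hf => (mem_inducedEdges.1 (Finset.mem_sdiff.1 hf).1).2 }
  have hfin : H.IsFinite := ⟨W.finite_toSet, Finset.finite_toSet _⟩
  have hconn : H.IsConnected := by
    refine H.isConnected_of_linked 1 hW.1 fun b hb => (hW.2 b hb).of_forall ?_
    intro g j hgj
    by_cases hgR : (g, j) ∈ R
    · obtain ⟨d, hd, hde⟩ := Finset.mem_image.1 hgR
      simp only [Prod.mk.injEq] at hde
      obtain ⟨rfl, rfl⟩ := hde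
      have := hP.translate d
      rw [← mul_assoc] at this
      refine this.mono fun f hf => ?_
      have hf' : (d⁻¹ * f.1, f.2) ∈ P := hf
      refine Finset.mem_sdiff.2 ⟨by simpa using hDP d hd _ hf', fun hfR => ?_⟩
      obtain ⟨d', hd', rfl⟩ := Finset.mem_image.1 hfR
      rw [← mul_assoc] at hf'
      by_cases hdd : d = d'
      · subst hdd
        exact heP (by simpa using hf')
      · exact hsep d hd d' hd' hdd hf'
    · exact Linked.of_mem (Finset.mem_sdiff.2 ⟨hgj, hgR⟩)
  have h1 := H.beta2_add_beta0 hfin hconn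
  have h2 : H.beta0 = W.card := Set.ncard_coe_finset W
  have h3 : H.edges.ncard = (inducedEdges x W \ R).card := Set.ncard_coe_finset _
  have h4 := Finset.card_sdiff_add_card_eq_card hRsub
  -- Euler's formula for the connected graph `H`, with `0 ≤ H.beta2`
  omega

open scoped Pointwise in
/-- If the generators satisfy a nontrivial relation, then the number of independent cycles in a
ball grows linearly with the size of the ball. -/
theorem exists_xi_unitBall_ge [DecidableEq G] (hx : Subgroup.closure (Set.range x) = ⊤)
    (hinj : ¬ Function.Injective (FreeGroup.lift x)) :
    ∃ c : ℝ, 0 < c ∧ ∃ l : ℕ, ∀ i, c ≤ (inducedSubgraph x (unitBall x ^ (i + l))).xi := by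
  obtain ⟨e, P, hPf, heP, hP⟩ := exists_bypassed_edge x hinj
  -- a ball containing `e` and `P`
  let V : Finset G := (insert e hPf.toFinset).biUnion fun f => {f.1, f.1 * x f.2}
  obtain ⟨l, hl⟩ := exists_subset_unitBall_pow hx V
  have hV : ∀ f, f = e ∨ f ∈ P → f.1 ∈ unitBall x ^ l ∧ f.1 * x f.2 ∈ unitBall x ^ l := by
    intro f hf
    have hf' : f ∈ insert e hPf.toFinset := by simpa using hf
    exact ⟨hl (Finset.mem_biUnion.2 ⟨f, hf', by simp⟩), hl (Finset.mem_biUnion.2 ⟨f, hf', by simp⟩)⟩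
  -- contains each `t` for which the translate of `e` by `t` belongs to `P`
  let T : Finset G := hPf.toFinset.image fun p => p.1 * e.1⁻¹
  set M := (insert 1 (T ∪ T⁻¹)).card * (unitBall x ^ l).card
  have hM : 0 < M := Nat.mul_pos (Finset.card_pos.2 ⟨1, Finset.mem_insert_self _ _⟩)
    (Finset.card_pos.2 ⟨1, (isRooted_unitBall_pow l).1⟩)
  have hM' : (0 : ℝ) < M := by exact_mod_cast hM
  refine ⟨1 / M, by positivity, l, fun i => ?_⟩
  obtain ⟨D, hDB, hsep, hcard⟩ := exists_separated_subset T (unitBall x ^ i)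
  set W := unitBall x ^ (i + l) with hW
  have hroot : IsRooted x W := isRooted_unitBall_pow _
  have hin : ∀ d ∈ D, ∀ f, f = e ∨ f ∈ P → (d * f.1, f.2) ∈ inducedEdges x W := by
    intro d hd f hf
    obtain ⟨h1, h2⟩ := hV f hf
    rw [mem_inducedEdges, hW, pow_add]
    refine ⟨Finset.mul_mem_mul (hDB hd) h1, ?_⟩
    dsimp only
    rw [mul_assoc]
    exact Finset.mul_mem_mul (hDB hd) h2
  have hkey := card_add_card_le_of_separated heP hP hroot D (fun d hd => hin d hd e (Or.inl rfl))
    (fun d hd p hp => hin d hd p (Or.inr hp)) (fun d hd d' hd' hne hmem =>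
      hsep d hd d' hd' hne (Finset.mem_image.2 ⟨_, hPf.mem_toFinset.2 hmem, by simp⟩))
  have hWc : W.card ≤ D.card * M := by
    calc W.card ≤ (unitBall x ^ i).card * (unitBall x ^ l).card := by
          rw [hW, pow_add]; exact Finset.card_mul_le
      _ ≤ D.card * (insert 1 (T ∪ T⁻¹)).card * (unitBall x ^ l).card := by gcongr
      _ = D.card * M := mul_assoc _ _ _
  have hWpos : (0 : ℝ) < W.card := by exact_mod_cast Finset.card_pos.2 ⟨1, hroot.1⟩
  have hkey' : (D.card : ℝ) + W.card ≤ (inducedEdges x W).card + 1 := by exact_mod_cast hkey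
  have hWc' : (W.card : ℝ) ≤ D.card * M := by exact_mod_cast hWc
  rw [xi_inducedSubgraph hroot]
  have h1 : 1 / (M : ℝ) ≤ D.card / W.card := by
    rw [div_le_div_iff₀ hM' hWpos]; linarith
  refine h1.trans ?_
  rw [div_le_iff₀ hWpos]
  have : ((inducedEdges x W).card / (W.card : ℝ) - 1 + 1 / W.card) * W.card =
      (inducedEdges x W).card - W.card + 1 := by field_simp
  rw [this]
  linarith

end Circuit

/-! ### The cyclomatic quotient -/

section Quotient

variable {n : ℕ} {G : Type u} [Group G] {x : Fin n → G} {C : ℕ → CayleySubgraph x}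

theorem IsExhaustingChain.mono (hC : IsExhaustingChain C) {i j : ℕ} (h : i ≤ j) : C i ≤ C j := by
  induction j, h using Nat.le_induction with
  | base => exact ⟨subset_rfl, subset_rfl⟩
  | succ j _ ih => exact ⟨ih.1.trans (hC.le_succ j).1, ih.2.trans (hC.le_succ j).2⟩

theorem IsExhaustingChain.exists_subset_verts (hC : IsExhaustingChain C) (F : Finset G) :
    ∃ i, ∀ j, i ≤ j → (F : Set G) ⊆ (C j).verts := by
  choose i hi using hC.verts_exhaust
  exact ⟨F.sup i, fun j hj g hg => (hC.mono ((Finset.le_sup hg).trans hj)).1 (hi g)⟩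

theorem IsExhaustingChain.tendsto_beta0 [Infinite G] (hC : IsExhaustingChain C) :
    Tendsto (fun i => (C i).beta0) atTop atTop := by
  refine tendsto_atTop.2 fun m => ?_
  obtain ⟨F, hF⟩ := Infinite.exists_subset_card_eq G m
  obtain ⟨i, hi⟩ := hC.exists_subset_verts F
  filter_upwards [eventually_ge_atTop i] with j hj
  rw [← hF, ← Set.ncard_coe_finset F]
  exact Set.ncard_le_ncard (hi j hj) (hC.finite j).1

theorem IsExhaustingChain.tendsto_one_div [Infinite G] (hC : IsExhaustingChain C) (c : ℝ) :
    Tendsto (fun i => c + 1 / ((C i).beta0 : ℝ)) atTop (nhds c) := by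
  have h1 : Tendsto (fun i => ((C i).beta0 : ℝ)) atTop atTop :=
    tendsto_natCast_atTop_atTop.comp hC.tendsto_beta0
  simpa using (tendsto_inv_atTop_zero.comp h1).const_add c

theorem eta_le_of_tendsto {u : ℕ → ℝ} {c : ℝ} (hu : Tendsto u atTop (nhds c))
    (h : ∀ᶠ i in atTop, (C i).xi ≤ u i) : eta C ≤ c := by
  have hu' : Tendsto (fun i => (u i : EReal)) atTop (nhds (c : EReal)) :=
    (continuous_coe_real_ereal.tendsto c).comp hu
  rw [← hu'.limsup_eq]
  exact limsup_le_limsup (h.mono fun i hi => EReal.coe_le_coe_iff.2 hi)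

theorem le_eta_of_tendsto {u : ℕ → ℝ} {c : ℝ} (hu : Tendsto u atTop (nhds c))
    (h : ∀ᶠ i in atTop, u i ≤ (C i).xi) : (c : EReal) ≤ eta C := by
  have hu' : Tendsto (fun i => (u i : EReal)) atTop (nhds (c : EReal)) :=
    (continuous_coe_real_ereal.tendsto c).comp hu
  rw [← hu'.limsup_eq]
  exact limsup_le_limsup (h.mono fun i hi => EReal.coe_le_coe_iff.2 hi)

theorem cyclomaticQuotient_le {c : EReal}
    (h : ∀ C : ℕ → CayleySubgraph x, IsExhaustingChain C → eta C ≤ c) :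
    cyclomaticQuotient x ≤ c :=
  iSup_le fun C => h C.1 C.2

theorem IsExhaustingChain.eta_le (hC : IsExhaustingChain C) : eta C ≤ cyclomaticQuotient x :=
  le_iSup (fun C : {C : ℕ → CayleySubgraph x // IsExhaustingChain C} => eta C.1) ⟨C, hC⟩

theorem cyclomaticQuotient_nonneg (hx : Subgroup.closure (Set.range x) = ⊤) :
    0 ≤ cyclomaticQuotient x := by
  classical
  refine le_trans ?_ (isExhaustingChain_balls hx).eta_le
  rw [← EReal.coe_zero]
  exact le_eta_of_tendsto tendsto_const_nhds
    (Eventually.of_forall fun i => CayleySubgraph.xi_nonneg _)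

theorem cyclomaticQuotient_le_natCast : cyclomaticQuotient x ≤ ((n : ℝ) : EReal) := by
  refine cyclomaticQuotient_le fun C hC => eta_le_of_tendsto tendsto_const_nhds ?_
  refine Eventually.of_forall fun i => ((C i).xi_le (hC.finite i) (hC.connected i)).trans ?_
  have : (1 : ℝ) ≤ (C i).beta0 := by
    exact_mod_cast (C i).beta0_pos (hC.finite i) (hC.connected i)
  have := div_le_self zero_le_one this
  linarith

/-- An isoperimetric inequality for finite sets of vertices of an infinite Cayley graph bounds the
cyclomatic quotient, as the correction term in Euler's formula vanishes in the limit. -/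
theorem cyclomaticQuotient_le_of_forall [Infinite G] (c : ℝ)
    (h : ∀ F : Finset G, ((inducedEdges x F).card : ℝ) ≤ c * F.card) :
    cyclomaticQuotient x ≤ ((c - 1 : ℝ) : EReal) :=
  cyclomaticQuotient_le fun C hC => eta_le_of_tendsto (hC.tendsto_one_div (c - 1)) <|
    Eventually.of_forall fun i => (C i).xi_le_of_forall (hC.finite i) (hC.connected i) c h

theorem cyclomaticQuotient_of_finite [Finite G] (hx : Subgroup.closure (Set.range x) = ⊤) :
    cyclomaticQuotient x = ((n - 1 + 1 / (Nat.card G : ℝ) : ℝ) : EReal) := by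
  classical
  have key : ∀ C : ℕ → CayleySubgraph x, IsExhaustingChain C →
      eta C = ((n - 1 + 1 / (Nat.card G : ℝ) : ℝ) : EReal) := by
    intro C hC
    have hev : ∀ᶠ i in atTop, (C i).xi = n - 1 + 1 / (Nat.card G : ℝ) := by
      choose k hk using hC.edges_exhaust
      have : Fintype G := Fintype.ofFinite G
      obtain ⟨i, hi⟩ := hC.exists_subset_verts Finset.univ
      filter_upwards [eventually_ge_atTop i,
        eventually_ge_atTop ((Finset.univ : Finset (G × Fin n)).sup k)] with j hj hj'
      have hv : (C j).verts = Set.univ :=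
        Set.eq_univ_of_forall fun g => hi j hj (by simp)
      have he : (C j).edges = Set.univ := Set.eq_univ_of_forall fun e =>
        (hC.mono ((Finset.le_sup (Finset.mem_univ e)).trans hj')).2 (hk e)
      have hpos : (0 : ℝ) < Nat.card G := by exact_mod_cast Nat.card_pos
      rw [(C j).xi_eq (hC.finite j) (hC.connected j), CayleySubgraph.beta0, hv, he,
        Set.ncard_univ, Set.ncard_univ, Nat.card_prod, Nat.card_eq_fintype_card (α := Fin n),
        Fintype.card_fin]
      push_cast
      field_simp
    exact le_antisymm (eta_le_of_tendsto tendsto_const_nhds (hev.mono fun i hi => hi.le))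
      (le_eta_of_tendsto tendsto_const_nhds (hev.mono fun i hi => hi.ge))
  refine le_antisymm (cyclomaticQuotient_le fun C hC => (key C hC).le) ?_
  rw [← key _ (isExhaustingChain_balls hx)]
  exact (isExhaustingChain_balls hx).eta_le

theorem cyclomaticQuotient_of_isAmenable [Infinite G] (hx : Subgroup.closure (Set.range x) = ⊤)
    (hG : IsAmenable G) : cyclomaticQuotient x = ((n - 1 : ℝ) : EReal) := by
  classical
  refine le_antisymm (cyclomaticQuotient_le_of_forall n fun F => by
    exact_mod_cast card_inducedEdges_le x F) ?_
  obtain ⟨W, hr, hC, hcard⟩ := exists_folner_chain hx (exists_folner_of_isAmenable x hG)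
  refine le_trans ?_ hC.eta_le
  have hlim : Tendsto (fun i : ℕ => (n : ℝ) - 1 / (i : ℝ) - 1) atTop (nhds (n - 1)) := by
    simpa using (tendsto_one_div_atTop_nhds_zero_nat.const_sub (n : ℝ)).sub_const 1
  refine le_eta_of_tendsto hlim ?_
  filter_upwards [eventually_ge_atTop 1] with i hi
  obtain ⟨i, rfl⟩ := Nat.exists_eq_add_of_le' hi
  rw [xi_inducedSubgraph (hr _)]
  have hpos : (0 : ℝ) < (W (i + 1)).card := by
    exact_mod_cast Finset.card_pos.2 ⟨1, (hr (i + 1)).1⟩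
  have h1 := (le_div_iff₀ hpos).2 (hcard i)
  have h2 : (0 : ℝ) < 1 / (W (i + 1)).card := by positivity
  push_cast
  linarith

/-- Without Følner sets the Cayley graph satisfies a strong isoperimetric inequality. -/
theorem exists_isoperimetric_of_not_isAmenable (hx : Subgroup.closure (Set.range x) = ⊤)
    (hG : ¬ IsAmenable G) :
    ∃ ε : ℝ, 0 < ε ∧ ∀ F : Finset G, ((inducedEdges x F).card : ℝ) ≤ (n - ε) * F.card := by
  by_contra! hcon
  refine hG (isAmenable_of_folner x hx fun ε hε => ?_)
  obtain ⟨F, hF⟩ := hcon ε hε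
  refine ⟨F, ?_, hF.le⟩
  by_contra hne
  rw [Finset.not_nonempty_iff_eq_empty] at hne
  subst hne
  simp [inducedEdges] at hF

theorem infinite_of_not_isAmenable (hx : Subgroup.closure (Set.range x) = ⊤)
    (hG : ¬ IsAmenable G) : Infinite G := by
  classical
  by_contra hfin
  rw [not_infinite_iff_finite] at hfin
  have : Fintype G := Fintype.ofFinite G
  obtain ⟨ε, hε, h⟩ := exists_isoperimetric_of_not_isAmenable hx hG
  have h1 := card_inducedEdges_add x Finset.univ
  simp only [Finset.mem_univ, not_true_eq_false, Finset.filter_false, Finset.card_empty,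
    add_zero] at h1
  have h2 := h Finset.univ
  rw [h1] at h2
  have h3 : (0 : ℝ) < (Finset.univ : Finset G).card := by
    exact_mod_cast Finset.card_pos.2 ⟨1, Finset.mem_univ _⟩
  have := mul_pos hε h3
  push_cast at h2
  linarith

/-- If the generators are a free basis, the Cayley graph is a tree and the cyclomatic quotient
vanishes. -/
theorem cyclomaticQuotient_le_zero_of_injective [Infinite G]
    (hx : Subgroup.closure (Set.range x) = ⊤) (hinj : Function.Injective (FreeGroup.lift x)) :
    cyclomaticQuotient x ≤ 0 := by
  classical
  have hsurj : Function.Surjective (FreeGroup.lift x) := by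
    rw [← MonoidHom.range_eq_top, FreeGroup.range_lift_eq_closure, hx]
  let φ : FreeGroup (Fin n) ≃* G := MulEquiv.ofBijective _ ⟨hinj, hsurj⟩
  have hφ : ∀ j, φ.symm (x j) = FreeGroup.of j := fun j => by
    rw [MulEquiv.symm_apply_eq]
    exact (FreeGroup.lift_apply_of ..).symm
  have key : ∀ F : Finset G, ((inducedEdges x F).card : ℝ) ≤ 1 * F.card := by
    intro F
    have h1 := card_inducedEdges_le_of_free (F.image φ.symm)
    rw [Finset.card_image_of_injective _ φ.symm.injective] at h1
    rw [one_mul]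
    refine Nat.cast_le.2 (le_trans ?_ h1)
    refine Finset.card_le_card_of_injOn (fun e => (φ.symm e.1, e.2)) ?_ ?_
    · intro e he
      obtain ⟨h2, h3⟩ := mem_inducedEdges.1 he
      refine mem_inducedEdges.2 ⟨Finset.mem_image_of_mem _ h2, ?_⟩
      have := Finset.mem_image_of_mem φ.symm h3
      rwa [map_mul, hφ] at this
    · rintro ⟨g, j⟩ - ⟨g', j'⟩ - h
      simpa using h
  simpa using cyclomaticQuotient_le_of_forall 1 key

/-- A nontrivial relation among the generators makes the cyclomatic quotient positive. -/
theorem cyclomaticQuotient_pos (hx : Subgroup.closure (Set.range x) = ⊤)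
    (hinj : ¬ Function.Injective (FreeGroup.lift x)) : 0 < cyclomaticQuotient x := by
  classical
  obtain ⟨c, hc, l, h⟩ := exists_xi_unitBall_ge hx hinj
  refine lt_of_lt_of_le (EReal.coe_pos.2 hc) ?_
  refine le_trans ?_ (isExhaustingChain_balls hx).eta_le
  refine le_eta_of_tendsto tendsto_const_nhds ?_
  filter_upwards [eventually_ge_atTop l] with i hi
  obtain ⟨i, rfl⟩ := Nat.exists_eq_add_of_le' hi
  exact h i

end Quotient

end CyclomaticQuotient
end

open CyclomaticQuotient in
theorem proposition2p3 (n : ℕ) (R : Set (FreeGroup (Fin n))) :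
    (((1 - n : ℝ) : EReal) ≤ CyclomaticQuotient.normalizedCyclomaticQuotient R ∧
      CyclomaticQuotient.normalizedCyclomaticQuotient R ≤ 1) ∧
    (CyclomaticQuotient.IsAmenable (PresentedGroup R) →
      (Finite (PresentedGroup R) →
        CyclomaticQuotient.normalizedCyclomaticQuotient R =
          ((1 / (Nat.card (PresentedGroup R) : ℝ) : ℝ) : EReal)) ∧
      (Infinite (PresentedGroup R) →
        CyclomaticQuotient.normalizedCyclomaticQuotient R = 0)) ∧
    (¬ CyclomaticQuotient.IsAmenable (PresentedGroup R) →
      ((1 - n : ℝ) : EReal) ≤ CyclomaticQuotient.normalizedCyclomaticQuotient R ∧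
      CyclomaticQuotient.normalizedCyclomaticQuotient R < 0 ∧
      (CyclomaticQuotient.normalizedCyclomaticQuotient R = ((1 - n : ℝ) : EReal) ↔
        2 ≤ n ∧ Nonempty (PresentedGroup R ≃* FreeGroup (Fin n)))) := by
  set x : Fin n → PresentedGroup R := fun j => PresentedGroup.of j
  have hx : Subgroup.closure (Set.range x) = ⊤ := PresentedGroup.closure_range_of R
  -- the supremum over the exhausting chains is a real number `r` in `[0, n]`
  have h0 := cyclomaticQuotient_nonneg hx
  have hn := cyclomaticQuotient_le_natCast (x := x)
  obtain ⟨r, hr⟩ : ∃ r : ℝ, cyclomaticQuotient x = r := by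
    refine ⟨(cyclomaticQuotient x).toReal, (EReal.coe_toReal ?_ ?_).symm⟩
    · exact ne_top_of_le_ne_top (EReal.coe_ne_top _) hn
    · exact ne_bot_of_le_ne_bot EReal.zero_ne_bot h0
  have hΞ : normalizedCyclomaticQuotient R = ((1 - n + r : ℝ) : EReal) := by
    rw [normalizedCyclomaticQuotient, hr, ← EReal.coe_add]
  rw [hr] at h0 hn
  have h0' : 0 ≤ r := by exact_mod_cast h0
  have hn' : r ≤ n := by exact_mod_cast hn
  have hle : ((1 - n : ℝ) : EReal) ≤ normalizedCyclomaticQuotient R := by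
    rw [hΞ, EReal.coe_le_coe_iff]; linarith
  refine ⟨⟨hle, ?_⟩, fun hG => ⟨fun hfin => ?_, fun hinf => ?_⟩, fun hG => ?_⟩
  · rw [hΞ, ← EReal.coe_one, EReal.coe_le_coe_iff]; linarith
  · have := cyclomaticQuotient_of_finite hx
    rw [hr, EReal.coe_eq_coe_iff] at this
    rw [hΞ, this, EReal.coe_eq_coe_iff]; ring
  · have := cyclomaticQuotient_of_isAmenable hx hG
    rw [hr, EReal.coe_eq_coe_iff] at this
    rw [hΞ, this, ← EReal.coe_zero, EReal.coe_eq_coe_iff]; ring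
  · have hinf := infinite_of_not_isAmenable hx hG
    obtain ⟨ε, hε, hiso⟩ := exists_isoperimetric_of_not_isAmenable hx hG
    have hlt := cyclomaticQuotient_le_of_forall _ hiso
    rw [hr, EReal.coe_le_coe_iff] at hlt
    refine ⟨hle, ?_, ?_⟩
    · rw [hΞ, ← EReal.coe_zero, EReal.coe_lt_coe_iff]; linarith
    · rw [hΞ, EReal.coe_eq_coe_iff]
      have hsurj : Function.Surjective (FreeGroup.lift x) := by
        rw [← MonoidHom.range_eq_top, FreeGroup.range_lift_eq_closure, hx]
      constructor
      · intro h
        refine ⟨?_, ?_⟩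
        · have : (1 : ℝ) < n := by linarith
          exact_mod_cast this
        · by_cases hinj : Function.Injective (FreeGroup.lift x)
          · exact ⟨(MulEquiv.ofBijective _ ⟨hinj, hsurj⟩).symm⟩
          · have := cyclomaticQuotient_pos hx hinj
            rw [hr, EReal.coe_pos] at this
            linarith
      · rintro ⟨-, ⟨φ⟩⟩
        -- the generators form a free basis because free groups are Hopfian
        have hcomp := freeGroup_injective_of_surjective
          (φ.toMonoidHom.comp (FreeGroup.lift x)) (φ.surjective.comp hsurj)
        have hinj : Function.Injective (FreeGroup.lift x) :=
          Function.Injective.of_comp (f := φ) hcomp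
        have := cyclomaticQuotient_le_zero_of_injective hx hinj
        rw [hr, ← EReal.coe_zero, EReal.coe_le_coe_iff] at this
        linarith
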